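/- Let $\mathcal E$ be a category with finite limits and $(P,\mu,\eta)$ a cartesian monad on $\mathcal E$ ($P$ preserves pullbacks and all naturality squares of $\mu$ and $\eta$ are pullbacks), equipped with a strength, i.e. a natural transformation $D_{A,B}\colon A\times PB\to P(A\times B)$ such that: $Pp_2\circ D_{1,A}=p_2$; $D$ is compatible with the associativity isomorphisms of $\times$; $D_{A,B}\circ(A\times\eta_B)=\eta_{A\times B}$; and $D_{A,B}\circ(A\times\mu_B)=\mu_{A\times B}\circ PD_{A,B}\circ D_{A,PB}$. Write $D_A\colon A\times P1\to PA$ for $D_{A,1}$ followed by $P(A\times 1)\cong PA$. A $P$-operad $Q$ consists of a span $PQ_0\xleftarrow{s}Q_1\xrightarrow{t}Q_0$, a composition $m\colon PQ_1\times_{PQ_0}Q_1\to Q_1$ (pullback of $Pt$ and $s$) and a unit $e\colon Q_0\to Q_1$ such that $s\circ m=\mu_{Q_0}\circ Ps\circ p_1$, $t\circ m=t\circ p_2$, $s\circ e=\eta_{Q_0}$, $t\circ e=\mathrm{id}$, and the associativity and unit axioms hold. A morphism of $P$-operads is a pair $(f_0\colon Q_0\to Q_0',\,f_1\colon Q_1\to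 Q_1')$ compatible with $s$, $t$, $e$ and $m$. Let $C$ be a category internal to $\mathcal E$, with objects $C_0$, arrows $C_1$, source $s$, target $t\colon C_1\to C_0$, composition $c\colon C_2=C_1\times_{C_0}C_1\to C_1$ and unit $e\colon C_0\to C_1$. Define $T^P(C)$ as follows. * The object of colours is $C_0$, and the object of operations $\tilde C_1$ is the pullback of $Pt\colon PC_1\to PC_0$ and $D_{C_0}\colon C_0\times P1\to PC_0$, with source $\tilde C_1\to PC_1\xrightarrow{Ps}PC_0$ and target $\tilde C_1\to C_0\times P1\xrightarrow{p_1}C_0$. * There is an isomorphism of $\tilde C_2=P\tilde C_1\times_{PC_0}\tilde C_1$ with $\tilde C_2'=P^2C_1\times_{P^2C_0}P(C_1\times P1)\times_{P(C_0\times P1)}(C_0\times P^21)$ (the last pullback being along $P(t\times P1)$ and $D_{C_0,P1}$): its first component in $P\tilde C_1$ is given by the projection to $P^2C_1$ together with $P(s\times P1)$, and its second component in $\tilde C_1$ is given by the projection $P(C_1\times P1)\to PC_1$ together with $C_0\times P^21\to C_0\times P1$, the image of $P1\to 1$. The composition $\tilde C_2\cong\tilde C_2'\to\tilde C_1$ has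 as component in $PC_1$ the composite $\tilde C_2'\to P^2C_1\times_{P^2C_0}P^2C_1\cong P^2C_2\xrightarrow{P^2c}P^2C_1\xrightarrow{\mu}PC_1$, where the first map is the projection to $P^2C_1$ on the first factor and $PD_{C_1}\colon P(C_1\times P1)\to P^2C_1$ on the second, and as component in $C_0\times P1$ the composite $\tilde C_2'\to C_0\times P^21\xrightarrow{C_0\times\mu_1}C_0\times P1$. * The unit $C_0\to\tilde C_1$ has components $Pe\circ\eta_{C_0}\colon C_0\to PC_1$ and $C_0\cong C_0\times 1\xrightarrow{C_0\times\eta_1}C_0\times P1$. For an internal functor $f=(f_0,f_1)\colon C\to B$ let $\tilde f_1\colon\tilde C_1\to\tilde B_1$ be the map of pullbacks induced by $Pf_1$, $f_0\times P1$ and $Pf_0$. Then the following hold. 1. If $D_{C_0}$ is a monomorphism, then $T^P(C)$ is a $P$-operad. 2. If $f\colon C\to B$ is an internal functor and $D_{C_0}$ and $D_{B_0}$ are monomorphisms, then $T^P(f)=(f_0,\tilde f_1)$ is a morphism of $P$-operads $T^P(C)\to T^P(B)$. The assignment $f\mapsto T^P(f)$ preserves identities and composition. 3. If $D_A$ is a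 monomorphism for every object $A$ of $\mathcal E$, then $T^P$ is a functor from the category of categories internal to $\mathcal E$ to the category of $P$-operads. 4. Let $\mathcal E=\mathbf{Set}$ and let $P$ be the free semigroup monad $M^{\mathrm r}A=\bigsqcup_{n\ge 1}A^n$ with strength $(a,(b_1,\dots,b_n))\mapsto((a,b_1),\dots,(a,b_n))$. For every monoid $Y$, regarded as a category with one object, $T^{M^{\mathrm r}}(Y)$ is an $M^{\mathrm r}$-operad, and it is isomorphic, naturally in $Y$, to Giraudo's operad $TY$: the one-coloured operad whose $n$-ary operations ($n\ge 1$) are the $n$-tuples of elements of $Y$, whose unit is $(1)$, and whose partial compositions are $x\circ_i y=(x_1,\dots,x_{i-1},x_i y_1,\dots,x_i y_m,x_{i+1},\dots,x_n)$. Here the total composition of $TY$ is $x\circ(y_1,\dots,y_n)=(\cdots((x\circ_n y_n)\circ_{n-1}y_{n-1})\cdots)\circ_1 y_1$. -/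

import Mathlib

open CategoryTheory Limits MonoidalCategory CartesianMonoidalCategory

universe v u w

namespace TConstruction

/-- A monad is cartesian when its functor preserves pullbacks and all naturality squares of its
unit and of its multiplication are pullbacks. -/
class CartesianMonad {E : Type u} [Category.{v} E] (P : Monad E) : Prop where
  preserves : PreservesLimitsOfShape WalkingCospan P.toFunctor
  eta : NatTrans.Equifibered P.η
  mu : NatTrans.Equifibered P.μ

attribute [instance] CartesianMonad.preserves

/-- A strength `A × P B ⟶ P (A × B)` for a monad `P`. -/
structure Strength {E : Type u} [Category.{v} E] [CartesianMonoidalCategory E]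
    (P : Monad E) where
  app (A B : E) : A ⊗ P.obj B ⟶ P.obj (A ⊗ B)
  naturality {A A' B B' : E} (f : A ⟶ A') (g : B ⟶ B') :
    (f ⊗ₘ P.map g) ≫ app A' B' = app A B ≫ P.map (f ⊗ₘ g)
  one_tensor (A : E) : app (𝟙_ E) A ≫ P.map (snd (𝟙_ E) A) = snd (𝟙_ E) (P.obj A)
  tensor_tensor (A B C : E) :
    app (A ⊗ B) C ≫ P.map (α_ A B C).hom =
      (α_ A B (P.obj C)).hom ≫ (A ◁ app B C) ≫ app A (B ⊗ C)
  unit (A B : E) : (A ◁ P.η.app B) ≫ app A B = P.η.app (A ⊗ B)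
  mult (A B : E) :
    (A ◁ P.μ.app B) ≫ app A B =
      app A (P.obj B) ≫ P.map (app A B) ≫ P.μ.app (A ⊗ B)

/-- A category internal to `E`; `s` is the source, `t` the target, and `m` composes a pair
(first arrow, second arrow) such that the target of the first is the source of the second. -/
structure InternalCat (E : Type u) [Category.{v} E] [HasPullbacks E] where
  C₀ : E
  C₁ : E
  s : C₁ ⟶ C₀
  t : C₁ ⟶ C₀
  m : pullback t s ⟶ C₁
  e : C₀ ⟶ C₁
  m_s : m ≫ s = pullback.fst t s ≫ s
  m_t : m ≫ t = pullback.snd t s ≫ t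
  e_s : e ≫ s = 𝟙 C₀
  e_t : e ≫ t = 𝟙 C₀
  assoc :
    pullback.lift (f := t) (g := s)
        (pullback.fst (pullback.snd t s ≫ t) s ≫ m) (pullback.snd (pullback.snd t s ≫ t) s)
        (by rw [Category.assoc, m_t, pullback.condition]) ≫ m =
      pullback.lift (f := t) (g := s)
        (pullback.fst (pullback.snd t s ≫ t) s ≫ pullback.fst t s)
        (pullback.lift (f := t) (g := s)
          (pullback.fst (pullback.snd t s ≫ t) s ≫ pullback.snd t s)
          (pullback.snd (pullback.snd t s ≫ t) s)
          (by rw [Category.assoc, pullback.condition]) ≫ m)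
        (by rw [Category.assoc, Category.assoc, m_s, pullback.lift_fst_assoc, Category.assoc,
          pullback.condition]) ≫ m
  id_comp : pullback.lift (f := t) (g := s) (s ≫ e) (𝟙 C₁) (by simp [e_t]) ≫ m = 𝟙 C₁
  comp_id : pullback.lift (f := t) (g := s) (𝟙 C₁) (t ≫ e) (by simp [e_s]) ≫ m = 𝟙 C₁

/-- An internal functor. -/
@[ext]
structure InternalCat.Hom {E : Type u} [Category.{v} E] [HasPullbacks E]
    (C B : InternalCat E) where
  f₀ : C.C₀ ⟶ B.C₀
  f₁ : C.C₁ ⟶ B.C₁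
  comm_s : C.s ≫ f₀ = f₁ ≫ B.s
  comm_t : C.t ≫ f₀ = f₁ ≫ B.t
  comm_e : C.e ≫ f₁ = f₀ ≫ B.e
  comm_m : C.m ≫ f₁ = pullback.map C.t C.s B.t B.s f₁ f₁ f₀ comm_t comm_s ≫ B.m

/-- Categories internal to `E` form a category. -/
instance InternalCat.category {E : Type u} [Category.{v} E] [HasPullbacks E] :
    Category (InternalCat E) where
  Hom := InternalCat.Hom
  id C :=
    { f₀ := 𝟙 _, f₁ := 𝟙 _
      comm_s := by simp
      comm_t := by simp
      comm_e := by simp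
      comm_m := by simp }
  comp f g :=
    { f₀ := f.f₀ ≫ g.f₀, f₁ := f.f₁ ≫ g.f₁
      comm_s := by rw [← Category.assoc, f.comm_s, Category.assoc, g.comm_s, Category.assoc]
      comm_t := by rw [← Category.assoc, f.comm_t, Category.assoc, g.comm_t, Category.assoc]
      comm_e := by rw [← Category.assoc, f.comm_e, Category.assoc, g.comm_e, Category.assoc]
      comm_m := by
        rw [← Category.assoc, f.comm_m, Category.assoc, g.comm_m, ← Category.assoc,
          pullback.map_comp] }
  id_comp f := by apply InternalCat.Hom.ext <;> exact Category.id_comp _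
  comp_id f := by apply InternalCat.Hom.ext <;> exact Category.comp_id _
  assoc f g h := by apply InternalCat.Hom.ext <;> exact Category.assoc _ _ _

/-- The data of a `P`-operad, without its axioms: a span `P Q₀ ⟵ Q₁ ⟶ Q₀`, a composition
`P Q₁ ×_{P Q₀} Q₁ ⟶ Q₁` and a unit `Q₀ ⟶ Q₁`. -/
structure PreOperad {E : Type u} [Category.{v} E] [HasPullbacks E] (P : Monad E) where
  Q₀ : E
  Q₁ : E
  s : Q₁ ⟶ P.obj Q₀
  t : Q₁ ⟶ Q₀
  m : pullback (P.map t) s ⟶ Q₁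
  e : Q₀ ⟶ Q₁

/-- The axioms of a `P`-operad. In `assoc` the domain of both sides is
`P (P Q₁ ×_{P Q₀} Q₁) ×_{P Q₀} Q₁`. -/
structure PreOperad.IsOperad {E : Type u} [Category.{v} E] [HasPullbacks E] {P : Monad E}
    (Q : PreOperad P) : Prop where
  m_s : Q.m ≫ Q.s = pullback.fst (P.map Q.t) Q.s ≫ P.map Q.s ≫ P.μ.app Q.Q₀
  m_t : Q.m ≫ Q.t = pullback.snd (P.map Q.t) Q.s ≫ Q.t
  e_s : Q.e ≫ Q.s = P.η.app Q.Q₀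
  e_t : Q.e ≫ Q.t = 𝟙 Q.Q₀
  assoc :
    pullback.lift (f := P.map Q.t) (g := Q.s)
        (pullback.fst (P.map (pullback.snd (P.map Q.t) Q.s ≫ Q.t)) Q.s ≫ P.map Q.m)
        (pullback.snd (P.map (pullback.snd (P.map Q.t) Q.s ≫ Q.t)) Q.s)
        (by rw [Category.assoc, ← P.map_comp, m_t, pullback.condition]) ≫ Q.m =
      pullback.lift (f := P.map Q.t) (g := Q.s)
        (pullback.fst (P.map (pullback.snd (P.map Q.t) Q.s ≫ Q.t)) Q.s ≫
          P.map (pullback.fst (P.map Q.t) Q.s) ≫ P.μ.app Q.Q₁)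
        (pullback.lift (f := P.map Q.t) (g := Q.s)
          (pullback.fst (P.map (pullback.snd (P.map Q.t) Q.s ≫ Q.t)) Q.s ≫
            P.map (pullback.snd (P.map Q.t) Q.s))
          (pullback.snd (P.map (pullback.snd (P.map Q.t) Q.s ≫ Q.t)) Q.s)
          (by rw [Category.assoc, ← P.map_comp, pullback.condition]) ≫ Q.m)
        (by
          have h := P.μ.naturality Q.t
          dsimp at h
          rw [Category.assoc, Category.assoc, Category.assoc, m_s, pullback.lift_fst_assoc, ← h,
            Category.assoc, ← P.map_comp_assoc, ← P.map_comp_assoc, pullback.condition]) ≫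
        Q.m
  id_left :
    pullback.lift (f := P.map Q.t) (g := Q.s) (Q.s ≫ P.map Q.e) (𝟙 Q.Q₁)
      (by rw [Category.assoc, ← P.map_comp, e_t, P.map_id, Category.comp_id, Category.id_comp]) ≫
        Q.m = 𝟙 Q.Q₁
  id_right :
    pullback.lift (f := P.map Q.t) (g := Q.s) (P.η.app Q.Q₁) (Q.t ≫ Q.e)
      (by rw [Category.assoc, e_s]; exact (P.η.naturality Q.t).symm) ≫ Q.m = 𝟙 Q.Q₁

/-- A morphism of (pre-)`P`-operads. -/
@[ext]
structure PreOperad.Hom {E : Type u} [Category.{v} E] [HasPullbacks E] {P : Monad E}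
    (Q R : PreOperad P) where
  f₀ : Q.Q₀ ⟶ R.Q₀
  f₁ : Q.Q₁ ⟶ R.Q₁
  comm_s : Q.s ≫ P.map f₀ = f₁ ≫ R.s
  comm_t : Q.t ≫ f₀ = f₁ ≫ R.t
  comm_e : Q.e ≫ f₁ = f₀ ≫ R.e
  comm_m : Q.m ≫ f₁ =
    pullback.map (P.map Q.t) Q.s (P.map R.t) R.s (P.map f₁) f₁ (P.map f₀)
      (by rw [← P.map_comp, comm_t, P.map_comp]) comm_s ≫ R.m

instance PreOperad.category {E : Type u} [Category.{v} E] [HasPullbacks E] {P : Monad E} :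
    Category (PreOperad P) where
  Hom := PreOperad.Hom
  id C :=
    { f₀ := 𝟙 _, f₁ := 𝟙 _
      comm_s := by simp
      comm_t := by simp
      comm_e := by simp
      comm_m := by simp }
  comp f g :=
    { f₀ := f.f₀ ≫ g.f₀, f₁ := f.f₁ ≫ g.f₁
      comm_s := by
        rw [P.map_comp, ← Category.assoc, f.comm_s, Category.assoc, g.comm_s, Category.assoc]
      comm_t := by rw [← Category.assoc, f.comm_t, Category.assoc, g.comm_t, Category.assoc]
      comm_e := by rw [← Category.assoc, f.comm_e, Category.assoc, g.comm_e, Category.assoc]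
      comm_m := by
        rw [← Category.assoc, f.comm_m, Category.assoc, g.comm_m, ← Category.assoc,
          pullback.map_comp]
        congr 1
        apply pullback.hom_ext <;> simp }
  id_comp f := by apply PreOperad.Hom.ext <;> exact Category.id_comp _
  comp_id f := by apply PreOperad.Hom.ext <;> exact Category.comp_id _
  assoc f g h := by apply PreOperad.Hom.ext <;> exact Category.assoc _ _ _

/-- The category of `P`-operads. -/
abbrev POperad {E : Type u} [Category.{v} E] [HasPullbacks E] (P : Monad E) :=
  ObjectProperty.FullSubcategory (PreOperad.IsOperad (P := P))

section T

set_option linter.unusedSectionVars false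

variable {E : Type u} [Category.{v} E] [CartesianMonoidalCategory E] [HasPullbacks E]
  {P : Monad E} (D : Strength P)

/-- `D_A : A × P 1 ⟶ P A`, the strength at `(A, 1)` followed by `P (A × 1) ≅ P A`. -/
def Strength.one (A : E) : A ⊗ P.obj (𝟙_ E) ⟶ P.obj A :=
  D.app A (𝟙_ E) ≫ P.map (ρ_ A).hom

theorem Strength.app_snd (A B : E) : D.app A B ≫ P.map (snd A B) = snd A (P.obj B) := by
  have h := D.naturality (toUnit A) (𝟙 B)
  have h2 := congrArg (· ≫ P.map (snd (𝟙_ E) B)) h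
  simp only [Category.assoc, D.one_tensor] at h2
  rw [← P.map_comp] at h2
  simpa using h2.symm

theorem Strength.one_naturality {A B : E} (f : A ⟶ B) :
    (f ▷ P.obj (𝟙_ E)) ≫ D.one B = D.one A ≫ P.map f := by
  have h := D.naturality f (𝟙 (𝟙_ E))
  simp only [P.map_id, tensorHom_id] at h
  simp only [Strength.one]
  rw [← Category.assoc, h, Category.assoc, Category.assoc, ← P.map_comp, ← P.map_comp,
    rightUnitor_naturality]

theorem Strength.one_mult (A : E) :
    (A ◁ P.μ.app (𝟙_ E)) ≫ D.one A =
      D.app A (P.obj (𝟙_ E)) ≫ P.map (D.one A) ≫ P.μ.app A := by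
  have h : P.μ.app (A ⊗ 𝟙_ E) ≫ P.map (ρ_ A).hom = P.map (P.map (ρ_ A).hom) ≫ P.μ.app A :=
    (P.μ.naturality (ρ_ A).hom).symm
  rw [Strength.one, reassoc_of% (D.mult A (𝟙_ E)), h, P.map_comp, Category.assoc]

/-- The object of operations `C̃₁`, the pullback of `P C₁` and `C₀ × P 1` over `P C₀`. -/
noncomputable abbrev tOps (C : InternalCat E) : E := pullback (P.map C.t) (D.one C.C₀)

noncomputable abbrev tSource (C : InternalCat E) : tOps D C ⟶ P.obj C.C₀ :=
  pullback.fst (P.map C.t) (D.one C.C₀) ≫ P.map C.s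

noncomputable abbrev tTarget (C : InternalCat E) : tOps D C ⟶ C.C₀ :=
  pullback.snd (P.map C.t) (D.one C.C₀) ≫ fst C.C₀ (P.obj (𝟙_ E))

/-- The composable pairs of operations, `C̃₂ = P C̃₁ ×_{P C₀} C̃₁`. -/
noncomputable abbrev tPairs (C : InternalCat E) : E :=
  pullback (P.map (tTarget D C)) (tSource D C)

/-- `P² C₁ ×_{P² C₀} P (C₁ × P 1)` -/
noncomputable abbrev tInner (C : InternalCat E) : E :=
  pullback (P.map (P.map C.t)) (P.map (C.s ▷ P.obj (𝟙_ E)) ≫ P.map (D.one C.C₀))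

/-- `C̃₂* = P² C₁ ×_{P² C₀} P (C₁ × P 1) ×_{P (C₀ × P 1)} (C₀ × P² 1)`, isomorphic to `C̃₂`. -/
noncomputable abbrev tTriples (C : InternalCat E) : E :=
  pullback (pullback.snd (P.map (P.map C.t)) (P.map (C.s ▷ P.obj (𝟙_ E)) ≫ P.map (D.one C.C₀)) ≫
    P.map (C.t ▷ P.obj (𝟙_ E))) (D.app C.C₀ (P.obj (𝟙_ E)))

/-- The projection of `tTriples` to `P² C₁`. -/
noncomputable def tTriples.p₁ (C : InternalCat E) : tTriples D C ⟶ P.obj (P.obj C.C₁) :=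
  pullback.fst (pullback.snd (P.map (P.map C.t)) (P.map (C.s ▷ P.obj (𝟙_ E)) ≫
    P.map (D.one C.C₀)) ≫ P.map (C.t ▷ P.obj (𝟙_ E))) (D.app C.C₀ (P.obj (𝟙_ E))) ≫
  pullback.fst (P.map (P.map C.t)) (P.map (C.s ▷ P.obj (𝟙_ E)) ≫ P.map (D.one C.C₀))

/-- The projection of `tTriples` to `P (C₁ × P 1)`. -/
noncomputable def tTriples.p₂ (C : InternalCat E) :
    tTriples D C ⟶ P.obj (C.C₁ ⊗ P.obj (𝟙_ E)) :=
  pullback.fst (pullback.snd (P.map (P.map C.t)) (P.map (C.s ▷ P.obj (𝟙_ E)) ≫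
    P.map (D.one C.C₀)) ≫ P.map (C.t ▷ P.obj (𝟙_ E))) (D.app C.C₀ (P.obj (𝟙_ E))) ≫
  pullback.snd (P.map (P.map C.t)) (P.map (C.s ▷ P.obj (𝟙_ E)) ≫ P.map (D.one C.C₀))

/-- The projection of `tTriples` to `C₀ × P² 1`. -/
noncomputable def tTriples.p₃ (C : InternalCat E) :
    tTriples D C ⟶ C.C₀ ⊗ P.obj (P.obj (𝟙_ E)) :=
  pullback.snd (pullback.snd (P.map (P.map C.t)) (P.map (C.s ▷ P.obj (𝟙_ E)) ≫
    P.map (D.one C.C₀)) ≫ P.map (C.t ▷ P.obj (𝟙_ E))) (D.app C.C₀ (P.obj (𝟙_ E)))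

theorem tTriples.condition₁₂ (C : InternalCat E) :
    tTriples.p₁ D C ≫ P.map (P.map C.t) =
      tTriples.p₂ D C ≫ P.map (C.s ▷ P.obj (𝟙_ E)) ≫ P.map (D.one C.C₀) := by
  simp only [tTriples.p₁, tTriples.p₂, Category.assoc, pullback.condition]

theorem tTriples.condition₂₃ (C : InternalCat E) :
    tTriples.p₂ D C ≫ P.map (C.t ▷ P.obj (𝟙_ E)) =
      tTriples.p₃ D C ≫ D.app C.C₀ (P.obj (𝟙_ E)) := by
  simp only [tTriples.p₂, tTriples.p₃, Category.assoc, pullback.condition]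

theorem tTriples.hom_ext (C : InternalCat E) {X : E} {f g : X ⟶ tTriples D C}
    (h₁ : f ≫ tTriples.p₁ D C = g ≫ tTriples.p₁ D C)
    (h₂ : f ≫ tTriples.p₂ D C = g ≫ tTriples.p₂ D C)
    (h₃ : f ≫ tTriples.p₃ D C = g ≫ tTriples.p₃ D C) : f = g := by
  apply pullback.hom_ext
  · apply pullback.hom_ext
    · simpa only [tTriples.p₁, Category.assoc] using h₁
    · simpa only [tTriples.p₂, Category.assoc] using h₂
  · exact h₃

/-- The map into `tTriples` with given projections. -/
noncomputable def tTriples.lift {C : InternalCat E} {X : E} (a : X ⟶ P.obj (P.obj C.C₁))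
    (b : X ⟶ P.obj (C.C₁ ⊗ P.obj (𝟙_ E))) (c : X ⟶ C.C₀ ⊗ P.obj (P.obj (𝟙_ E)))
    (h : a ≫ P.map (P.map C.t) = b ≫ P.map (C.s ▷ P.obj (𝟙_ E)) ≫ P.map (D.one C.C₀))
    (h' : b ≫ P.map (C.t ▷ P.obj (𝟙_ E)) = c ≫ D.app C.C₀ (P.obj (𝟙_ E))) :
    X ⟶ tTriples D C :=
  pullback.lift (pullback.lift a b h) c (by rw [pullback.lift_snd_assoc, h'])

section

variable {C : InternalCat E} {X : E} (a : X ⟶ P.obj (P.obj C.C₁))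
    (b : X ⟶ P.obj (C.C₁ ⊗ P.obj (𝟙_ E))) (c : X ⟶ C.C₀ ⊗ P.obj (P.obj (𝟙_ E)))
    (h : a ≫ P.map (P.map C.t) = b ≫ P.map (C.s ▷ P.obj (𝟙_ E)) ≫ P.map (D.one C.C₀))
    (h' : b ≫ P.map (C.t ▷ P.obj (𝟙_ E)) = c ≫ D.app C.C₀ (P.obj (𝟙_ E)))

theorem tTriples.lift_p₁ : tTriples.lift D a b c h h' ≫ tTriples.p₁ D C = a := by
  rw [tTriples.lift, tTriples.p₁, pullback.lift_fst_assoc, pullback.lift_fst]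

theorem tTriples.lift_p₂ : tTriples.lift D a b c h h' ≫ tTriples.p₂ D C = b := by
  rw [tTriples.lift, tTriples.p₂, pullback.lift_fst_assoc, pullback.lift_snd]

theorem tTriples.lift_p₃ : tTriples.lift D a b c h h' ≫ tTriples.p₃ D C = c := by
  rw [tTriples.lift, tTriples.p₃, pullback.lift_snd]

end

/-- The naturality squares of the projection `A × Z ⟶ A` are pullbacks. -/
theorem isPullback_fst_whiskerRight {A B : E} (f : A ⟶ B) (Z : E) :
    IsPullback (fst A Z) (f ▷ Z) f (fst B Z) := by
  refine ⟨⟨by simp⟩, ⟨PullbackCone.IsLimit.mk _ (fun c => lift c.fst (c.snd ≫ snd B Z)) ?_ ?_ ?_⟩⟩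
  · intro c; simp
  · intro c
    ext
    · simp [c.condition]
    · simp
  · intro c k h1 h2
    ext
    · simp [h1]
    · simp [← h2]

theorem isPullback_snd_whiskerLeft {A B : E} (f : A ⟶ B) (Z : E) :
    IsPullback (Z ◁ f) (snd Z A) (snd Z B) f := by
  refine ⟨⟨by simp⟩, ⟨PullbackCone.IsLimit.mk _ (fun c => lift (c.fst ≫ fst Z B) c.snd) ?_ ?_ ?_⟩⟩
  · intro c
    ext
    · simp
    · simp [c.condition]
  · intro c; simp
  · intro c k h1 h2
    ext
    · simp [← h1]
    · simp [h2]

variable [CartesianMonad P]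

theorem Strength.isPullback (A : E) :
    IsPullback (A ◁ P.map (toUnit (P.obj (𝟙_ E)))) (D.app A (P.obj (𝟙_ E)))
      (D.app A (𝟙_ E)) (P.map (A ◁ toUnit (P.obj (𝟙_ E)))) := by
  have hb := (isPullback_snd_whiskerLeft (toUnit (P.obj (𝟙_ E))) A).map P.toFunctor
  have ht : IsPullback (A ◁ P.map (toUnit (P.obj (𝟙_ E))))
      (D.app A (P.obj (𝟙_ E)) ≫ P.map (snd A (P.obj (𝟙_ E))))
      (D.app A (𝟙_ E) ≫ P.map (snd A (𝟙_ E))) (P.map (toUnit (P.obj (𝟙_ E)))) := by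
    rw [D.app_snd, D.app_snd]
    exact isPullback_snd_whiskerLeft _ A
  refine IsPullback.of_bot ht ?_ hb
  simpa using D.naturality (𝟙 A) (toUnit (P.obj (𝟙_ E)))

theorem isPullback_map_pullback {X Y Z : E} (f : X ⟶ Z) (g : Y ⟶ Z) :
    IsPullback (P.map (pullback.fst f g)) (P.map (pullback.snd f g)) (P.map f) (P.map g) :=
  (IsPullback.of_hasPullback f g).map P.toFunctor

/-- The map `C̃₂* ⟶ P C̃₁`. -/
noncomputable def tTriples.toFst (C : InternalCat E) : tTriples D C ⟶ P.obj (tOps D C) :=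
  (isPullback_map_pullback (P.map C.t) (D.one C.C₀)).lift (tTriples.p₁ D C)
    (tTriples.p₂ D C ≫ P.map (C.s ▷ P.obj (𝟙_ E)))
    (by rw [tTriples.condition₁₂, Category.assoc])

theorem tTriples.toFst_fst (C : InternalCat E) :
    tTriples.toFst D C ≫ P.map (pullback.fst (P.map C.t) (D.one C.C₀)) = tTriples.p₁ D C :=
  IsPullback.lift_fst _ _ _ _

theorem tTriples.toFst_snd (C : InternalCat E) :
    tTriples.toFst D C ≫ P.map (pullback.snd (P.map C.t) (D.one C.C₀)) =
      tTriples.p₂ D C ≫ P.map (C.s ▷ P.obj (𝟙_ E)) :=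
  IsPullback.lift_snd _ _ _ _

/-- The map `C̃₂* ⟶ C̃₁`. -/
noncomputable def tTriples.toSnd (C : InternalCat E) : tTriples D C ⟶ tOps D C :=
  pullback.lift (tTriples.p₂ D C ≫ P.map (fst C.C₁ (P.obj (𝟙_ E))))
    (tTriples.p₃ D C ≫ (C.C₀ ◁ P.map (toUnit (P.obj (𝟙_ E)))))
    (by
      have h1 := tTriples.condition₂₃ D C
      have h2 := (D.isPullback C.C₀).w
      have h3 : D.one C.C₀ = D.app C.C₀ (𝟙_ E) ≫ P.map (fst _ _) := by
        rw [Strength.one, rightUnitor_hom]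
      rw [h3, Category.assoc, Category.assoc, reassoc_of% h2, ← P.map_comp, ← P.map_comp,
        whiskerLeft_fst, ← whiskerRight_fst C.t, P.map_comp, reassoc_of% h1])

theorem tTriples.condition (C : InternalCat E) :
    tTriples.toFst D C ≫ P.map (tTarget D C) = tTriples.toSnd D C ≫ tSource D C := by
  rw [tTarget, tSource, P.map_comp, reassoc_of% (tTriples.toFst_snd D C), tTriples.toSnd,
    pullback.lift_fst_assoc]
  simp only [Category.assoc, ← P.map_comp, whiskerRight_fst]

/-- The map `C̃₂ ⟶ P (C₁ × P 1)`. -/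
noncomputable def tPairs.toMid (C : InternalCat E) :
    tPairs D C ⟶ P.obj (C.C₁ ⊗ P.obj (𝟙_ E)) :=
  ((isPullback_fst_whiskerRight C.s (P.obj (𝟙_ E))).map P.toFunctor).lift
    (pullback.snd (P.map (tTarget D C)) (tSource D C) ≫ pullback.fst (P.map C.t) (D.one C.C₀))
    (pullback.fst (P.map (tTarget D C)) (tSource D C) ≫
      P.map (pullback.snd (P.map C.t) (D.one C.C₀)))
    (by
      have h := pullback.condition (f := P.map (tTarget D C)) (g := tSource D C)
      simp only [Category.assoc, P.map_comp] at h ⊢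
      exact h.symm)

theorem tPairs.toMid_fst (C : InternalCat E) :
    tPairs.toMid D C ≫ P.map (fst C.C₁ (P.obj (𝟙_ E))) =
      pullback.snd (P.map (tTarget D C)) (tSource D C) ≫
        pullback.fst (P.map C.t) (D.one C.C₀) :=
  IsPullback.lift_fst _ _ _ _

theorem tPairs.toMid_whisker (C : InternalCat E) :
    tPairs.toMid D C ≫ P.map (C.s ▷ P.obj (𝟙_ E)) =
      pullback.fst (P.map (tTarget D C)) (tSource D C) ≫
        P.map (pullback.snd (P.map C.t) (D.one C.C₀)) :=
  IsPullback.lift_snd _ _ _ _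

/-- The map `C̃₂ ⟶ C₀ × P² 1`. -/
noncomputable def tPairs.toLast (C : InternalCat E) :
    tPairs D C ⟶ C.C₀ ⊗ P.obj (P.obj (𝟙_ E)) :=
  (D.isPullback C.C₀).lift
    (pullback.snd (P.map (tTarget D C)) (tSource D C) ≫ pullback.snd (P.map C.t) (D.one C.C₀))
    (tPairs.toMid D C ≫ P.map (C.t ▷ P.obj (𝟙_ E)))
    (by
      have h1 := tPairs.toMid_fst D C
      have h2 := pullback.condition (f := P.map C.t) (g := D.one C.C₀)
      rw [← cancel_mono (P.map (ρ_ C.C₀).hom)]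
      simp only [Category.assoc]
      rw [← Strength.one, ← h2, ← reassoc_of% h1]
      simp only [← P.map_comp]
      congr 2
      simp [rightUnitor_hom])

theorem tPairs.toLast_fst (C : InternalCat E) :
    tPairs.toLast D C ≫ (C.C₀ ◁ P.map (toUnit (P.obj (𝟙_ E)))) =
      pullback.snd (P.map (tTarget D C)) (tSource D C) ≫
        pullback.snd (P.map C.t) (D.one C.C₀) :=
  IsPullback.lift_fst _ _ _ _

theorem tPairs.toLast_snd (C : InternalCat E) :
    tPairs.toLast D C ≫ D.app C.C₀ (P.obj (𝟙_ E)) =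
      tPairs.toMid D C ≫ P.map (C.t ▷ P.obj (𝟙_ E)) :=
  IsPullback.lift_snd _ _ _ _

/-- The isomorphism between `C̃₂* = P² C₁ ×_{P² C₀} P (C₁ × P 1) ×_{P (C₀ × P 1)} (C₀ × P² 1)`
and `C̃₂ = P C̃₁ ×_{P C₀} C̃₁`. -/
noncomputable def tPairsIso (C : InternalCat E) : tTriples D C ≅ tPairs D C where
  hom := pullback.lift (tTriples.toFst D C) (tTriples.toSnd D C) (tTriples.condition D C)
  inv := tTriples.lift D
    (pullback.fst (P.map (tTarget D C)) (tSource D C) ≫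
      P.map (pullback.fst (P.map C.t) (D.one C.C₀)))
    (tPairs.toMid D C) (tPairs.toLast D C)
    (by rw [reassoc_of% (tPairs.toMid_whisker D C), Category.assoc, ← P.map_comp, ← P.map_comp,
          pullback.condition])
    (tPairs.toLast_snd D C).symm
  hom_inv_id := by
    have hm : pullback.lift (f := P.map (tTarget D C)) (g := tSource D C)
        (tTriples.toFst D C) (tTriples.toSnd D C) (tTriples.condition D C) ≫ tPairs.toMid D C =
          tTriples.p₂ D C := by
      apply ((isPullback_fst_whiskerRight C.s (P.obj (𝟙_ E))).map P.toFunctor).hom_ext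
      · rw [Category.assoc, tPairs.toMid_fst, pullback.lift_snd_assoc, tTriples.toSnd,
          pullback.lift_fst]
      · rw [Category.assoc, tPairs.toMid_whisker, pullback.lift_fst_assoc, tTriples.toFst_snd]
    apply tTriples.hom_ext
    · rw [Category.id_comp, Category.assoc, tTriples.lift_p₁, pullback.lift_fst_assoc,
        tTriples.toFst_fst]
    · rw [Category.id_comp, Category.assoc, tTriples.lift_p₂, hm]
    · rw [Category.id_comp, Category.assoc, tTriples.lift_p₃]
      apply (D.isPullback C.C₀).hom_ext
      · rw [Category.assoc, tPairs.toLast_fst, pullback.lift_snd_assoc, tTriples.toSnd,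
          pullback.lift_snd]
      · rw [Category.assoc, tPairs.toLast_snd, reassoc_of% hm, tTriples.condition₂₃]
  inv_hom_id := by
    apply pullback.hom_ext
    · rw [Category.id_comp, Category.assoc, pullback.lift_fst]
      apply (isPullback_map_pullback (P.map C.t) (D.one C.C₀)).hom_ext
      · rw [Category.assoc, tTriples.toFst_fst, tTriples.lift_p₁]
      · rw [Category.assoc, tTriples.toFst_snd, reassoc_of% (tTriples.lift_p₂ D), tPairs.toMid_whisker]
    · rw [Category.id_comp, Category.assoc, pullback.lift_snd, tTriples.toSnd]
      apply pullback.hom_ext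
      · rw [Category.assoc, pullback.lift_fst, reassoc_of% (tTriples.lift_p₂ D), tPairs.toMid_fst]
      · rw [Category.assoc, pullback.lift_snd, reassoc_of% (tTriples.lift_p₃ D), tPairs.toLast_fst]

/-- The map `C̃₂* ⟶ P² C₂`, induced by `P D : P (C₁ × P 1) ⟶ P² C₁`. -/
noncomputable def tTriples.toComposable (C : InternalCat E) :
    tTriples D C ⟶ P.obj (P.obj (pullback C.t C.s)) :=
  ((isPullback_map_pullback (P := P) C.t C.s).map P.toFunctor).lift (tTriples.p₁ D C)
    (tTriples.p₂ D C ≫ P.map (D.one C.C₁))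
    (by
      have h := tTriples.condition₁₂ D C
      refine h.trans ?_
      rw [Category.assoc]
      congr 1
      simp only [← P.map_comp]
      rw [D.one_naturality])

theorem tTriples.toComposable_snd (C : InternalCat E) :
    tTriples.toComposable D C ≫ P.map (P.map (pullback.snd C.t C.s)) =
      tTriples.p₂ D C ≫ P.map (D.one C.C₁) :=
  IsPullback.lift_snd _ _ _ _

/-- The composition on `C̃₂*`: compose in `C` under `P²` and multiply. -/
noncomputable def tCompTriples (C : InternalCat E) : tTriples D C ⟶ tOps D C :=
  pullback.lift (tTriples.toComposable D C ≫ P.map (P.map C.m) ≫ P.μ.app C.C₁)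
    (tTriples.p₃ D C ≫ (C.C₀ ◁ P.μ.app (𝟙_ E)))
    (by
      have hμ {X Y : E} (f : X ⟶ Y) : P.μ.app X ≫ P.map f = P.map (P.map f) ≫ P.μ.app Y :=
        (P.μ.naturality f).symm
      rw [Category.assoc, Category.assoc, hμ, ← P.map_comp_assoc, ← P.map_comp, C.m_t, P.map_comp,
        P.map_comp, Category.assoc, reassoc_of% (tTriples.toComposable_snd D C), Category.assoc,
        Strength.one_mult, reassoc_of% (tTriples.condition₂₃ D C).symm, ← P.map_comp_assoc,
        ← D.one_naturality, P.map_comp, Category.assoc])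

/-- The composition `C̃₂ ⟶ C̃₁`. -/
noncomputable def tComp (C : InternalCat E) : tPairs D C ⟶ tOps D C :=
  (tPairsIso D C).inv ≫ tCompTriples D C

/-- The unit `C₀ ⟶ C̃₁`. -/
noncomputable def tUnit (C : InternalCat E) : C.C₀ ⟶ tOps D C :=
  pullback.lift (P.η.app C.C₀ ≫ P.map C.e)
    ((ρ_ C.C₀).inv ≫ (C.C₀ ◁ P.η.app (𝟙_ E)))
    (by
      have hη {X Y : E} (f : X ⟶ Y) : P.η.app X ≫ P.map f = f ≫ P.η.app Y :=
        (P.η.naturality f).symm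
      rw [Category.assoc, ← P.map_comp, C.e_t, P.map_id, Category.comp_id, Category.assoc,
        Strength.one, reassoc_of% (D.unit C.C₀ (𝟙_ E)), hη, Iso.inv_hom_id_assoc])

/-- The data of the `P`-operad `T^P(C)`. -/
noncomputable def T (C : InternalCat E) : PreOperad P where
  Q₀ := C.C₀
  Q₁ := tOps D C
  s := tSource D C
  t := tTarget D C
  m := tComp D C
  e := tUnit D C

/-- The action of the construction on operations. -/
noncomputable def tMap {C B : InternalCat E} (f : C ⟶ B) : tOps D C ⟶ tOps D B :=
  pullback.map (P.map C.t) (D.one C.C₀) (P.map B.t) (D.one B.C₀)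
    (P.map f.f₁) (f.f₀ ▷ P.obj (𝟙_ E)) (P.map f.f₀)
    (by rw [← P.map_comp, f.comm_t, P.map_comp])
    (D.one_naturality f.f₀).symm

end T

/-- The list of letters of a nonempty word. -/
def letters {A : Type u} (x : FreeSemigroup A) : List A := x.head :: x.tail

/-- The nonempty word with a given list of letters. -/
def word {A : Type u} (l : List A) (h : l ≠ []) : FreeSemigroup A := ⟨l.head h, l.tail⟩

theorem letters_word {A : Type u} (l : List A) (h : l ≠ []) : letters (word l h) = l :=
  List.cons_head_tail h

theorem letters_ne_nil {A : Type u} (x : FreeSemigroup A) : letters x ≠ [] :=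
  List.cons_ne_nil _ _

theorem letters_injective {A : Type u} : Function.Injective (letters (A := A)) := by
  rintro ⟨a, l⟩ ⟨b, k⟩ h
  simp only [letters, List.cons.injEq] at h
  exact FreeSemigroup.ext h.1 h.2

theorem letters_mul {A : Type u} (x y : FreeSemigroup A) :
    letters (x * y) = letters x ++ letters y := rfl

theorem letters_map {A B : Type u} (f : A → B) (x : FreeSemigroup A) :
    letters (FreeSemigroup.map f x) = (letters x).map f := by
  induction x using FreeSemigroup.recOnMul with
  | ih1 a => rfl
  | ih2 a y _ hy =>
    rw [map_mul, letters_mul, letters_mul, List.map_append, hy]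
    rfl

theorem letters_lift {A B : Type u} (f : A → FreeSemigroup B) (x : FreeSemigroup A) :
    letters (FreeSemigroup.lift f x) = (letters x).flatMap fun a => letters (f a) := by
  induction x using FreeSemigroup.recOnMul with
  | ih1 a => simp [letters]
  | ih2 a y _ hy =>
    rw [map_mul, letters_mul, letters_mul, List.flatMap_append, hy]
    simp [letters]

/-- The free semigroup monad on types. -/
abbrev freeSemigroupMonad : Monad (Type u) := ofTypeMonad FreeSemigroup

theorem letters_monad_map {A B : Type u} (f : A ⟶ B) (x : FreeSemigroup A) :
    letters (freeSemigroupMonad.map f x) = (letters x).map f :=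
  letters_map f x

theorem letters_mu {A : Type u} (x : FreeSemigroup (FreeSemigroup A)) :
    letters (freeSemigroupMonad.μ.app A x) = (letters x).flatMap letters :=
  letters_lift id x

theorem map_lift_id {A C : Type u} (f : A → C) (x : FreeSemigroup (FreeSemigroup A)) :
    FreeSemigroup.map f (FreeSemigroup.lift id x) =
      FreeSemigroup.lift id (FreeSemigroup.map (FreeSemigroup.map f) x) := by
  apply letters_injective
  rw [letters_map, letters_lift, letters_lift, letters_map, List.map_flatMap, List.flatMap_map]
  exact congrArg (fun h => List.flatMap h (letters x)) (funext fun y => (letters_map f y).symm)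

theorem map_map_word {A B C : Type u} (f : B → C) (g : A → B) (x : FreeSemigroup A) :
    FreeSemigroup.map f (FreeSemigroup.map g x) = FreeSemigroup.map (f ∘ g) x := by
  apply letters_injective
  rw [letters_map, letters_map, letters_map, List.map_map]

/-- The strength `(a, b₁ ⋯ bₙ) ↦ (a, b₁) ⋯ (a, bₙ)` of the free semigroup monad. -/
def freeSemigroupStrength : Strength freeSemigroupMonad.{u} where
  app A B := ↾fun p : A × FreeSemigroup B => FreeSemigroup.map (fun b => (p.1, b)) p.2
  naturality f g := by
    ext ⟨a, x⟩
    apply letters_injective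
    erw [letters_map, letters_map, letters_map, letters_map]
    simp
    rfl
  one_tensor A := by
    ext ⟨a, x⟩
    apply letters_injective
    erw [letters_map, letters_map, List.map_map]
    exact List.map_id _
  tensor_tensor A B C := by
    ext ⟨⟨a, b⟩, x⟩
    apply letters_injective
    erw [letters_map, letters_map, letters_map, letters_map]
    simp
    rfl
  unit A B := rfl
  mult A B := by
    ext ⟨a, x⟩
    exact (map_lift_id (fun b => (a, b)) x).trans (congrArg (FreeSemigroup.lift id)
      (map_map_word (fun p : A × FreeSemigroup B => FreeSemigroup.map (fun b => (p.1, b)) p.2)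
        (fun y => (a, y)) x).symm)

theorem exists_map_eq {A B X Z : Type u} (p : X → A) (q : X → B) (f : A → Z) (g : B → Z)
    (h : ∀ a b, f a = g b → ∃ x, p x = a ∧ q x = b) :
    ∀ (l : List A) (k : List B), l.map f = k.map g → ∃ r : List X, r.map p = l ∧ r.map q = k
  | [], [], _ => ⟨[], rfl, rfl⟩
  | [], _ :: _, e => by simp at e
  | _ :: _, [], e => by simp at e
  | a :: l, b :: k, e => by
    simp only [List.map_cons, List.cons.injEq] at e
    obtain ⟨x, hx, hx'⟩ := h a b e.1
    obtain ⟨r, hr, hr'⟩ := exists_map_eq p q f g h l k e.2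
    exact ⟨x :: r, by simp [hx, hr], by simp [hx', hr']⟩

theorem map_ext {A B X : Type u} (p : X → A) (q : X → B)
    (h : ∀ x y, p x = p y → q x = q y → x = y) :
    ∀ l k : List X, l.map p = k.map p → l.map q = k.map q → l = k
  | [], [], _, _ => rfl
  | [], _ :: _, e, _ => by simp at e
  | _ :: _, [], e, _ => by simp at e
  | a :: l, b :: k, e, e' => by
    simp only [List.map_cons, List.cons.injEq] at e e'
    rw [h a b e.1 e'.1, map_ext p q h l k e.2 e'.2]

theorem exists_flatMap_eq {A B : Type u} (f : A → B) :
    ∀ (K : List (FreeSemigroup B)) (l : List A), l.map f = K.flatMap letters →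
      ∃ L : List (FreeSemigroup A), L.map (FreeSemigroup.map f) = K ∧ L.flatMap letters = l
  | [], l, e => by
    refine ⟨[], rfl, ?_⟩
    simpa using e.symm
  | y :: K, l, e => by
    rw [List.flatMap_cons, List.map_eq_append_iff] at e
    obtain ⟨l₁, l₂, rfl, h₁, h₂⟩ := e
    obtain ⟨L, hL, hL'⟩ := exists_flatMap_eq f K l₂ h₂
    have hne : l₁ ≠ [] := by
      rintro rfl
      exact letters_ne_nil y h₁.symm
    refine ⟨word l₁ hne :: L, ?_, ?_⟩
    · rw [List.map_cons, hL]
      congr 1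
      apply letters_injective
      rw [letters_map, letters_word, h₁]
    · rw [List.flatMap_cons, letters_word, hL']

theorem flatMap_ext {A B : Type u} (f : A → B) :
    ∀ L K : List (FreeSemigroup A), L.map (FreeSemigroup.map f) = K.map (FreeSemigroup.map f) →
      L.flatMap letters = K.flatMap letters → L = K
  | [], [], _, _ => rfl
  | [], _ :: _, e, _ => by simp at e
  | _ :: _, [], e, _ => by simp at e
  | a :: L, b :: K, e, e' => by
    simp only [List.map_cons, List.cons.injEq] at e
    rw [List.flatMap_cons, List.flatMap_cons] at e'
    have hlen : (letters a).length = (letters b).length := by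
      have := congrArg (fun x => (letters x).length) e.1
      simpa [letters_map] using this
    obtain ⟨h₁, h₂⟩ := List.append_inj e' hlen
    rw [letters_injective h₁, flatMap_ext f L K e.2 h₂]

theorem isPullback_freeSemigroup_map {X₁ X₂ X₃ X₄ : Type u} {t : X₁ ⟶ X₂} {l : X₁ ⟶ X₃}
    {r : X₂ ⟶ X₄} {b : X₃ ⟶ X₄} (h : IsPullback t l r b) :
    IsPullback (freeSemigroupMonad.map t) (freeSemigroupMonad.map l)
      (freeSemigroupMonad.map r) (freeSemigroupMonad.map b) := by
  obtain ⟨h₀, h₁, h₂⟩ := (Types.isPullback_iff _ _ _ _).1 h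
  refine (Types.isPullback_iff _ _ _ _).2 ⟨?_, ?_, ?_⟩
  · rw [← Functor.map_comp, ← Functor.map_comp, h₀]
  · rintro x y ⟨hx, hy⟩
    have hx' : (letters x).map t = (letters y).map t :=
      (letters_monad_map t x).symm.trans ((congrArg letters hx).trans (letters_monad_map t y))
    have hy' : (letters x).map l = (letters y).map l :=
      (letters_monad_map l x).symm.trans ((congrArg letters hy).trans (letters_monad_map l y))
    exact letters_injective (map_ext t l (fun x y hx hy => h₁ x y ⟨hx, hy⟩) _ _ hx' hy')
  · intro x y hxy
    have hxy' : (letters x).map r = (letters y).map b :=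
      (letters_monad_map r x).symm.trans ((congrArg letters hxy).trans (letters_monad_map b y))
    obtain ⟨k, hk, hk'⟩ := exists_map_eq t l r b h₂ _ _ hxy'
    have hne : k ≠ [] := by
      rintro rfl
      exact letters_ne_nil x hk.symm
    refine ⟨word k hne, letters_injective ?_, letters_injective ?_⟩
    · exact (letters_monad_map t _).trans ((congrArg _ (letters_word k hne)).trans hk)
    · exact (letters_monad_map l _).trans ((congrArg _ (letters_word k hne)).trans hk')

/-- The free semigroup monad is cartesian. -/
instance freeSemigroupMonad_cartesian : CartesianMonad freeSemigroupMonad.{u} where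
  preserves :=
    ⟨fun {K} => by
      have : PreservesLimit (cospan (K.map WalkingCospan.Hom.inl) (K.map WalkingCospan.Hom.inr))
          freeSemigroupMonad.{u}.toFunctor :=
        preservesLimit_of_preserves_limit_cone
          (pullbackIsPullback (K.map WalkingCospan.Hom.inl) (K.map WalkingCospan.Hom.inr))
          ((isLimitMapConePullbackConeEquiv freeSemigroupMonad.{u}.toFunctor
            pullback.condition).symm
              (isPullback_freeSemigroup_map (IsPullback.of_hasPullback _ _)).isLimit)
      exact preservesLimit_of_iso_diagram _ (diagramIsoCospan K).symm⟩
  eta A B f := by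
    refine (Types.isPullback_iff _ _ _ _).2 ⟨freeSemigroupMonad.η.naturality f, ?_, ?_⟩
    · rintro x y ⟨_, h⟩
      exact congrArg FreeSemigroup.head h
    · intro b x h
      have h' : [b] = (letters x).map f := (congrArg letters h).trans (letters_monad_map f x)
      obtain ⟨a, k⟩ := x
      have hk : k = [] := by
        have := congrArg List.length h'
        simpa [letters] using this
      subst hk
      exact ⟨a, (List.cons.inj h').1.symm, rfl⟩
  mu A B f := by
    refine (Types.isPullback_iff _ _ _ _).2 ⟨freeSemigroupMonad.μ.naturality f, ?_, ?_⟩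
    · rintro x y ⟨h, h'⟩
      have hh : (letters x).map (FreeSemigroup.map f) = (letters y).map (FreeSemigroup.map f) :=
        (letters_map _ x).symm.trans ((congrArg letters h).trans (letters_map _ y))
      have hh' : (letters x).flatMap letters = (letters y).flatMap letters :=
        (letters_mu x).symm.trans ((congrArg letters h').trans (letters_mu y))
      exact letters_injective (flatMap_ext f _ _ hh hh')
    · intro K l h
      have h' : (letters K).flatMap letters = (letters l).map f :=
        (letters_mu K).symm.trans ((congrArg letters h).trans (letters_monad_map f l))
      obtain ⟨L, hL, hL'⟩ := exists_flatMap_eq f _ _ h'.symm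
      have hne : L ≠ [] := by
        rintro rfl
        exact letters_ne_nil K hL.symm
      refine ⟨word L hne, letters_injective ?_, letters_injective ?_⟩
      · exact (letters_map (FreeSemigroup.map f) _).trans
          ((congrArg _ (letters_word L hne)).trans hL)
      · exact (letters_mu _).trans ((congrArg _ (letters_word L hne)).trans hL')

/-- The map to the one-point type. -/
abbrev toPoint (X : Type u) : X ⟶ (PUnit.{u + 1} : Type u) := ↾fun _ => PUnit.unit

/-- The map sending a pair `(a, b)` of elements of a monoid to `b * a`. -/
noncomputable def monoidMul (Y : Type u) [Monoid Y] : pullback (toPoint Y) (toPoint Y) ⟶ Y :=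
  ↾fun w => pullback.snd (toPoint Y) (toPoint Y) w * pullback.fst (toPoint Y) (toPoint Y) w

theorem monoidMul_apply (Y : Type u) [Monoid Y] (w : (pullback (toPoint Y) (toPoint Y) : Type u)) :
    monoidMul Y w =
      pullback.snd (toPoint Y) (toPoint Y) w * pullback.fst (toPoint Y) (toPoint Y) w := rfl

theorem lift_monoidMul (Y : Type u) [Monoid Y] {X : Type u} (a b : X ⟶ Y)
    (h : a ≫ toPoint Y = b ≫ toPoint Y) (x : X) :
    monoidMul Y (pullback.lift a b h x) = b x * a x :=
  congrArg₂ (· * ·) (ConcreteCategory.congr_hom (pullback.lift_snd a b h) x)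
    (ConcreteCategory.congr_hom (pullback.lift_fst a b h) x)

/-- A monoid as a one-object category internal to types, with composition `g ∘ f = g * f`. -/
noncomputable def monoidCat (Y : Type u) [Monoid Y] : InternalCat (Type u) where
  C₀ := PUnit
  C₁ := Y
  s := toPoint Y
  t := toPoint Y
  m := monoidMul Y
  e := ↾fun _ => 1
  m_s := rfl
  m_t := rfl
  e_s := rfl
  e_t := rfl
  assoc := by
    refine ConcreteCategory.hom_ext _ _ fun w => ?_
    refine (lift_monoidMul Y _ _ _ w).trans (Eq.trans ?_ (lift_monoidMul Y _ _ _ w).symm)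
    refine Eq.trans ?_ (congrArg (· * _) (lift_monoidMul Y _ _ _ w).symm)
    exact (mul_assoc _ _ _).symm
  id_comp := by
    refine ConcreteCategory.hom_ext _ _ fun w => ?_
    exact (lift_monoidMul Y _ _ _ w).trans (mul_one _)
  comp_id := by
    refine ConcreteCategory.hom_ext _ _ fun w => ?_
    exact (lift_monoidMul Y _ _ _ w).trans (one_mul _)

/-- A monoid homomorphism as an internal functor. -/
noncomputable def monoidCatMap {Y Z : Type u} [Monoid Y] [Monoid Z] (f : Y →* Z) :
    monoidCat Y ⟶ monoidCat Z where
  f₀ := 𝟙 _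
  f₁ := ↾f
  comm_s := rfl
  comm_t := rfl
  comm_e := by
    refine ConcreteCategory.hom_ext _ _ fun w => ?_
    exact map_one f
  comm_m := by
    refine ConcreteCategory.hom_ext _ _ fun w => ?_
    exact (map_mul f _ _).trans (lift_monoidMul Z
      (pullback.fst (toPoint Y) (toPoint Y) ≫ ↾f) (pullback.snd (toPoint Y) (toPoint Y) ≫ ↾f)
      rfl w).symm

/-- Giraudo's partial composition of tuples,
`x ∘ᵢ y = (x₁, …, xᵢ₋₁, xᵢ y₁, …, xᵢ yₘ, xᵢ₊₁, …, xₙ)`, with `i` counted from `0`. -/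
def giraudoPartial {Y : Type u} [Monoid Y] (x : FreeSemigroup Y) (i : Fin (letters x).length)
    (y : FreeSemigroup Y) : FreeSemigroup Y :=
  word ((letters x).take i ++ (letters y).map (fun b => (letters x)[i] * b) ++
    (letters x).drop (i + 1)) (by simp [letters_ne_nil])

/-- The total composition `x ∘ (y₁, …, yₙ) = (⋯((x ∘ₙ yₙ) ∘ₙ₋₁ yₙ₋₁)⋯) ∘₁ y₁` obtained from the
partial compositions. -/
def giraudoTotal {Y : Type u} [Monoid Y] (x : FreeSemigroup Y) (ys : List (FreeSemigroup Y)) :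
    FreeSemigroup Y :=
  ys.zipIdx.foldr
    (fun p z => if h : p.2 < (letters z).length then giraudoPartial z ⟨p.2, h⟩ p.1 else z) x

/-- Giraudo's operad `T Y` on a monoid `Y`, as an operad for the free semigroup monad: it has one
colour, its `n`-ary operations are the `n`-tuples of elements of `Y` for `n ≥ 1`, and its unit
is the 1-tuple `(1)`. -/
noncomputable def giraudo (Y : Type u) [Monoid Y] : PreOperad freeSemigroupMonad.{u} where
  Q₀ := PUnit
  Q₁ := FreeSemigroup Y
  s := freeSemigroupMonad.map (toPoint Y)
  t := toPoint (FreeSemigroup Y)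
  m := ↾fun w => giraudoTotal
    (pullback.snd (freeSemigroupMonad.map (toPoint (FreeSemigroup Y)))
      (freeSemigroupMonad.map (toPoint Y)) w)
    (letters (pullback.fst (freeSemigroupMonad.map (toPoint (FreeSemigroup Y)))
      (freeSemigroupMonad.map (toPoint Y)) w))
  e := ↾fun _ => FreeSemigroup.of 1

end TConstruction

open TConstruction

namespace TConstruction

/-! ### Naturality of the monad; products as pullbacks over the terminal object -/

section Monad

variable {E : Type u} [Category.{v} E]

/-! An operation of `T^P(C)` is a word of arrows of `C` whose targets are all one colour. Discarding
`A` turns `D_A : A × P 1 ⟶ P A` into the projection to `P 1`, so the component of an operation in `P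
1`, its weight, is the shape of its word of arrows. A map into `C̃₁` is therefore determined by its
component in `P C₁` and its target (`tOps_hom_ext`). Every axiom splits into an equation of targets,
which is immediate since a composite has the target of its outer operation, and an equation in `P
C₁`.

To compute in `P C₁`, a composite is described by the word of words of composable pairs in `P² C₂`
that it multiplies. As `P` preserves pullbacks, maps into `P² C₂` and `P (C₁ × P 1)` are determined
by their projections, so any candidate with the right projections computes the composite
(`lift_tComp_fst`). Functoriality follows by applying an internal functor to the candidates. For the
unit laws the candidates pair each arrow with an identity of `C`, and the unit laws of `C` and of
`P` finish.

For associativity (`exists_composable_assoc`) three layers of operations yield one map into `P³` of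
the object of composable triples, the outer arrows being copied along the inner layers by the
strength. Both bracketings are images of this map, and they agree by associativity in `C` and in
`P`.

For a monoid `Y` the object of colours is terminal, so `D_{C₀}` is invertible and `C̃₁ ⟶ P Y` is an
isomorphism. It respects composition because both compositions have the letters `xᵢ yᵢⱼ` in the same
order. -/

theorem Monad.map_η {P : Monad E} {X Y : E} (f : X ⟶ Y) :
    P.η.app X ≫ P.map f = f ≫ P.η.app Y :=
  (P.η.naturality f).symm

theorem Monad.map_η_map {P : Monad E} {X Y : E} (f : X ⟶ Y) :
    P.map (P.η.app X) ≫ P.map (P.map f) = P.map f ≫ P.map (P.η.app Y) := by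
  rw [← P.map_comp, Monad.map_η, P.map_comp]

theorem Monad.map_μ {P : Monad E} {X Y : E} (f : X ⟶ Y) :
    P.μ.app X ≫ P.map f = P.map (P.map f) ≫ P.μ.app Y :=
  (P.μ.naturality f).symm

/-- `P` preserves pullbacks but not necessarily products, so products enter as pullbacks over the
terminal object. -/
theorem isPullback_fst_snd [CartesianMonoidalCategory E] (A B : E) :
    IsPullback (fst A B) (snd A B) (toUnit A) (toUnit B) := by
  refine ⟨⟨toUnit_unique _ _⟩, ⟨PullbackCone.IsLimit.mk _ (fun c => lift c.fst c.snd)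
    (fun c => lift_fst _ _) (fun c => lift_snd _ _) fun c k h1 h2 => ?_⟩⟩
  ext
  · simp [h1]
  · simp [h2]

end Monad

/-! ### Operations and composites in terms of their components -/

section T

set_option linter.unusedSectionVars false

variable {E : Type u} [Category.{v} E] [CartesianMonoidalCategory E] [HasPullbacks E]
  {P : Monad E} (D : Strength P)

/-- The weight `C̃₁ ⟶ P 1` of an operation. -/
noncomputable abbrev tWeight (C : InternalCat E) : tOps D C ⟶ P.obj (𝟙_ E) :=
  pullback.snd (P.map C.t) (D.one C.C₀) ≫ snd C.C₀ (P.obj (𝟙_ E))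

/-- The instance of `Strength.app_snd` at the terminal object. It makes the weight of an operation
redundant. -/
theorem Strength.one_toUnit (A : E) :
    D.one A ≫ P.map (toUnit A) = snd A (P.obj (𝟙_ E)) := by
  rw [Strength.one, Category.assoc, ← P.map_comp, ← D.app_snd]
  congr 2
  exact toUnit_unique _ _

/-- The weight is determined by the component in `P C₁`. -/
theorem tWeight_eq (C : InternalCat E) :
    tWeight D C = pullback.fst (P.map C.t) (D.one C.C₀) ≫ P.map (toUnit C.C₁) := by
  -- Reading the weight through `D_{C₀}` allows the pullback condition to replace it by `P t`; all
  -- maps to the terminal object agree.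
  rw [tWeight, ← D.one_toUnit, ← reassoc_of% pullback.condition (f := P.map C.t) (g := D.one C.C₀),
    ← P.map_comp]
  congr 2
  exact toUnit_unique _ _

/-- An operation is determined by its component in `P C₁` and its target. -/
theorem tOps_hom_ext {C : InternalCat E} {X : E} {f g : X ⟶ tOps D C}
    (h : f ≫ pullback.fst (P.map C.t) (D.one C.C₀) = g ≫ pullback.fst (P.map C.t) (D.one C.C₀))
    (h' : f ≫ tTarget D C = g ≫ tTarget D C) : f = g := by
  apply pullback.hom_ext h
  ext
  · simpa only [Category.assoc] using h'
  · have e := tWeight_eq D C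
    simp only [tWeight] at e
    rw [Category.assoc, Category.assoc, e, reassoc_of% h]

/-- Naturality of the strength along `P 1 ⟶ 1`: spreading an element over a word and then forgetting
the letters of the word uses only its shape. -/
theorem Strength.app_toUnit (A : E) :
    D.app A (P.obj (𝟙_ E)) ≫ P.map (fst A (P.obj (𝟙_ E))) =
      (A ◁ P.map (toUnit (P.obj (𝟙_ E)))) ≫ D.one A := by
  have h := D.naturality (𝟙 A) (toUnit (P.obj (𝟙_ E)))
  rw [id_tensorHom, id_tensorHom] at h
  rw [Strength.one, reassoc_of% h, ← P.map_comp, rightUnitor_hom, whiskerLeft_fst]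

variable [CartesianMonad P]

theorem isPullback_map_fst_snd (A B : E) :
    IsPullback (P.map (fst A B)) (P.map (snd A B)) (P.map (toUnit A)) (P.map (toUnit B)) :=
  (isPullback_fst_snd A B).map P.toFunctor

/-- `toMid` is defined by a pullback along the source map. With `toMid_fst` this describes it by
product projections instead: the outer arrows, each with the weight of the inner operation attached
to it. -/
theorem tPairs.toMid_snd (C : InternalCat E) :
    tPairs.toMid D C ≫ P.map (snd C.C₁ (P.obj (𝟙_ E))) =
      pullback.fst (P.map (tTarget D C)) (tSource D C) ≫ P.map (tWeight D C) := by
  have h := tPairs.toMid_whisker D C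
  rw [← whiskerRight_snd C.s, P.map_comp, reassoc_of% h, ← P.map_comp]

/-- The map `C̃₂ ⟶ P² C₂` sending a pair of operations to the composable arrows that are
composed in `C`. -/
noncomputable def tPairs.toComposable (C : InternalCat E) :
    tPairs D C ⟶ P.obj (P.obj (pullback C.t C.s)) :=
  (tPairsIso D C).inv ≫ tTriples.toComposable D C

theorem tPairs.toComposable_fst (C : InternalCat E) :
    tPairs.toComposable D C ≫ P.map (P.map (pullback.fst C.t C.s)) =
      pullback.fst (P.map (tTarget D C)) (tSource D C) ≫
        P.map (pullback.fst (P.map C.t) (D.one C.C₀)) := by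
  rw [toComposable, Category.assoc]
  have h : tTriples.toComposable D C ≫ P.map (P.map (pullback.fst C.t C.s)) = tTriples.p₁ D C :=
    IsPullback.lift_fst _ _ _ _
  rw [h, tPairsIso, tTriples.lift_p₁]

theorem tPairs.toComposable_snd (C : InternalCat E) :
    tPairs.toComposable D C ≫ P.map (P.map (pullback.snd C.t C.s)) =
      tPairs.toMid D C ≫ P.map (D.one C.C₁) := by
  rw [toComposable, Category.assoc, tTriples.toComposable_snd, tPairsIso,
    reassoc_of% (tTriples.lift_p₂ D)]

theorem tComp_fst (C : InternalCat E) :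
    tComp D C ≫ pullback.fst (P.map C.t) (D.one C.C₀) =
      tPairs.toComposable D C ≫ P.map (P.map C.m) ≫ P.μ.app C.C₁ := by
  rw [tComp, tCompTriples, Category.assoc, pullback.lift_fst, tPairs.toComposable, Category.assoc]

/-- Neither the multiplication on `P² 1` nor the map `P² 1 ⟶ P 1` touches the factor `C₀`. -/
theorem tComp_target (C : InternalCat E) :
    tComp D C ≫ tTarget D C =
      pullback.snd (P.map (tTarget D C)) (tSource D C) ≫ tTarget D C := by
  have h : (tPairsIso D C).inv ≫ tTriples.p₃ D C = tPairs.toLast D C := by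
    rw [tPairsIso, tTriples.lift_p₃]
  have h' := tPairs.toLast_fst D C
  rw [tComp, tCompTriples, Category.assoc, pullback.lift_snd_assoc, Category.assoc, reassoc_of% h,
    whiskerLeft_fst, ← whiskerLeft_fst C.C₀ (P.map (toUnit (P.obj (𝟙_ E)))), reassoc_of% h']

/-- Maps into `P² C₂` agree when their components in `P² C₁` do. -/
theorem map_map_pullback_hom_ext {X Y Z W : E} {f : X ⟶ Z} {g : Y ⟶ Z}
    {a b : W ⟶ P.obj (P.obj (pullback f g))}
    (h : a ≫ P.map (P.map (pullback.fst f g)) = b ≫ P.map (P.map (pullback.fst f g)))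
    (h' : a ≫ P.map (P.map (pullback.snd f g)) = b ≫ P.map (P.map (pullback.snd f g))) : a = b :=
  ((isPullback_map_pullback (P := P) f g).map P.toFunctor).hom_ext h h'

/-- The component in `P C₁` of the composition of two operations. -/
theorem lift_tComp_fst {C : InternalCat E} {X : E} (a : X ⟶ P.obj (tOps D C)) (b : X ⟶ tOps D C)
    (h : a ≫ P.map (tTarget D C) = b ≫ tSource D C)
    (c : X ⟶ P.obj (P.obj (pullback C.t C.s))) (d : X ⟶ P.obj (C.C₁ ⊗ P.obj (𝟙_ E)))
    (hc : c ≫ P.map (P.map (pullback.fst C.t C.s)) =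
      a ≫ P.map (pullback.fst (P.map C.t) (D.one C.C₀)))
    (hc' : c ≫ P.map (P.map (pullback.snd C.t C.s)) = d ≫ P.map (D.one C.C₁))
    (hd : d ≫ P.map (fst C.C₁ (P.obj (𝟙_ E))) = b ≫ pullback.fst (P.map C.t) (D.one C.C₀))
    (hd' : d ≫ P.map (snd C.C₁ (P.obj (𝟙_ E))) = a ≫ P.map (tWeight D C)) :
    pullback.lift a b h ≫ tComp D C ≫ pullback.fst (P.map C.t) (D.one C.C₀) =
      c ≫ P.map (P.map C.m) ≫ P.μ.app C.C₁ := by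
  -- `P (C₁ × P 1)` is a pullback over `P 1`, so the two projections pin down `d`; the same
  -- principle then pins down `c`.
  have hm : pullback.lift a b h ≫ tPairs.toMid D C = d := by
    apply (isPullback_map_fst_snd _ _).hom_ext
    · rw [Category.assoc, tPairs.toMid_fst, pullback.lift_snd_assoc, hd]
    · rw [Category.assoc, tPairs.toMid_snd, pullback.lift_fst_assoc, hd']
  have hu : pullback.lift a b h ≫ tPairs.toComposable D C = c := by
    apply map_map_pullback_hom_ext
    · rw [Category.assoc, tPairs.toComposable_fst, pullback.lift_fst_assoc, hc]
    · rw [Category.assoc, tPairs.toComposable_snd, reassoc_of% hm, hc']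
  rw [tComp_fst, reassoc_of% hu]

/-! ### Functoriality in the internal category -/

theorem tMap_fst {C B : InternalCat E} (f : C ⟶ B) :
    tMap D f ≫ pullback.fst (P.map B.t) (D.one B.C₀) =
      pullback.fst (P.map C.t) (D.one C.C₀) ≫ P.map f.f₁ :=
  pullback.lift_fst _ _ _

theorem tMap_target {C B : InternalCat E} (f : C ⟶ B) :
    tMap D f ≫ tTarget D B = tTarget D C ≫ f.f₀ := by
  rw [tMap, pullback.map, pullback.lift_snd_assoc, Category.assoc, whiskerRight_fst,
    Category.assoc]

theorem tMap_weight {C B : InternalCat E} (f : C ⟶ B) :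
    tMap D f ≫ tWeight D B = tWeight D C := by
  rw [tMap, pullback.map, pullback.lift_snd_assoc, Category.assoc, whiskerRight_snd]

theorem tMap_source {C B : InternalCat E} (f : C ⟶ B) :
    tMap D f ≫ tSource D B = tSource D C ≫ P.map f.f₀ := by
  have h := tMap_fst D f
  rw [tSource, reassoc_of% h, ← P.map_comp, ← f.comm_s, P.map_comp, Category.assoc]

theorem tMap_id (C : InternalCat E) : tMap D (𝟙 C) = 𝟙 (tOps D C) := by
  apply tOps_hom_ext
  · rw [tMap_fst, Category.id_comp]
    exact (congrArg _ (P.map_id _)).trans (Category.comp_id _)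
  · rw [tMap_target, Category.id_comp]
    exact Category.comp_id _

theorem tMap_comp {C B A : InternalCat E} (f : C ⟶ B) (g : B ⟶ A) :
    tMap D (f ≫ g) = tMap D f ≫ tMap D g := by
  apply tOps_hom_ext
  · have h := tMap_fst D f
    rw [tMap_fst, Category.assoc, tMap_fst, reassoc_of% h, ← P.map_comp]
    rfl
  · rw [tMap_target, Category.assoc (tMap D f), tMap_target, ← Category.assoc (tMap D f),
      tMap_target, Category.assoc (tTarget D C)]
    rfl

theorem tUnit_fst (C : InternalCat E) :
    tUnit D C ≫ pullback.fst (P.map C.t) (D.one C.C₀) = P.η.app C.C₀ ≫ P.map C.e :=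
  pullback.lift_fst _ _ _

theorem tUnit_target (C : InternalCat E) : tUnit D C ≫ tTarget D C = 𝟙 C.C₀ := by
  rw [tUnit, pullback.lift_snd_assoc, Category.assoc, whiskerLeft_fst, rightUnitor_inv_fst]

theorem tUnit_weight (C : InternalCat E) :
    tUnit D C ≫ tWeight D C = toUnit C.C₀ ≫ P.η.app (𝟙_ E) := by
  have h := tUnit_fst D C
  rw [tWeight_eq, reassoc_of% h, ← P.map_comp, Monad.map_η, toUnit_unique (C.e ≫ toUnit C.C₁)]

theorem tUnit_tMap {C B : InternalCat E} (f : C ⟶ B) :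
    tUnit D C ≫ tMap D f = f.f₀ ≫ tUnit D B := by
  apply tOps_hom_ext
  · have h := tUnit_fst D C
    rw [Category.assoc, Category.assoc, tMap_fst, tUnit_fst, reassoc_of% h, ← P.map_comp,
      f.comm_e, P.map_comp, reassoc_of% Monad.map_η f.f₀]
  · rw [Category.assoc (tUnit D C), Category.assoc f.f₀, tMap_target, tUnit_target,
      ← Category.assoc (tUnit D C), tUnit_target, Category.comp_id, Category.id_comp]

theorem tComp_tMap {C B : InternalCat E} (f : C ⟶ B) :
    tComp D C ≫ tMap D f =
      pullback.map (P.map (tTarget D C)) (tSource D C) (P.map (tTarget D B)) (tSource D B)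
        (P.map (tMap D f)) (tMap D f) (P.map f.f₀)
        (by rw [← P.map_comp, ← P.map_comp, tMap_target]) (tMap_source D f).symm ≫ tComp D B := by
  apply tOps_hom_ext
  · rw [Category.assoc, Category.assoc, tMap_fst]
    -- The composable pairs for `B` are the images under `f` of those for `C`; the weights do not
    -- change.
    refine Eq.trans ?_ (lift_tComp_fst D _ _ _
      (tPairs.toComposable D C ≫
        P.map (P.map (pullback.map C.t C.s B.t B.s f.f₁ f.f₁ f.f₀ f.comm_t f.comm_s)))
      (tPairs.toMid D C ≫ P.map (f.f₁ ▷ P.obj (𝟙_ E))) ?_ ?_ ?_ ?_).symm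
    · have h := tComp_fst D C
      rw [reassoc_of% h, Monad.map_μ, Category.assoc, ← P.map_comp_assoc, ← P.map_comp, f.comm_m]
      simp only [P.map_comp, Category.assoc]
    · have h := tPairs.toComposable_fst D C
      rw [Category.assoc, ← P.map_comp, ← P.map_comp, pullback.map, pullback.lift_fst, P.map_comp,
        P.map_comp, reassoc_of% h, Category.assoc, ← P.map_comp, ← P.map_comp, tMap_fst]
    · have h := tPairs.toComposable_snd D C
      rw [Category.assoc, ← P.map_comp, ← P.map_comp, pullback.map, pullback.lift_snd, P.map_comp,
        P.map_comp, reassoc_of% h, Category.assoc, ← P.map_comp, ← P.map_comp, D.one_naturality]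
    · have h := tPairs.toMid_fst D C
      rw [Category.assoc, ← P.map_comp, whiskerRight_fst, P.map_comp, reassoc_of% h,
        Category.assoc, tMap_fst]
    · rw [Category.assoc, ← P.map_comp, whiskerRight_snd, tPairs.toMid_snd, Category.assoc,
        ← P.map_comp, tMap_weight]
  · refine (Category.assoc _ _ _).trans (Eq.trans ?_ (Category.assoc _ _ _).symm)
    rw [tComp_target, pullback.lift_snd_assoc, Category.assoc (pullback.snd _ _) (tMap D f),
      tMap_target, ← Category.assoc (tComp D C), tComp_target, Category.assoc (pullback.snd _ _)]

/-- The morphism of operads induced by an internal functor. -/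
noncomputable def tHom {C B : InternalCat E} (f : C ⟶ B) : T D C ⟶ T D B where
  f₀ := f.f₀
  f₁ := tMap D f
  comm_s := (tMap_source D f).symm
  comm_t := (tMap_target D f).symm
  comm_e := tUnit_tMap D f
  comm_m := tComp_tMap D f

/-! ### Sources and unit laws -/

theorem tComp_source (C : InternalCat E) :
    tComp D C ≫ tSource D C =
      pullback.fst (P.map (tTarget D C)) (tSource D C) ≫ P.map (tSource D C) ≫ P.μ.app C.C₀ := by
  have h := tComp_fst D C
  have h' := tPairs.toComposable_fst D C
  rw [reassoc_of% h, Monad.map_μ, ← P.map_comp_assoc, ← P.map_comp, C.m_s, P.map_comp,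
    P.map_comp, Category.assoc, reassoc_of% h', ← P.map_comp_assoc]

theorem tUnit_source (C : InternalCat E) : tUnit D C ≫ tSource D C = P.η.app C.C₀ := by
  have h := tUnit_fst D C
  rw [tSource, reassoc_of% h, ← P.map_comp, C.e_s, P.map_id, Category.comp_id]

theorem tComp_id_left (C : InternalCat E)
    (h : (tSource D C ≫ P.map (tUnit D C)) ≫ P.map (tTarget D C) = 𝟙 _ ≫ tSource D C) :
    pullback.lift (tSource D C ≫ P.map (tUnit D C)) (𝟙 (tOps D C)) h ≫ tComp D C = 𝟙 _ := by
  apply tOps_hom_ext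
  -- The inner operations are units: each arrow is preceded by the identity of its source, and `P η`
  -- makes each inner word a single letter. Then `μ` cancels `P η`, and the identity law of `C`
  -- removes the identities.
  · rw [Category.assoc, lift_tComp_fst D _ _ _
      (pullback.fst (P.map C.t) (D.one C.C₀) ≫
        P.map (pullback.lift (C.s ≫ C.e) (𝟙 C.C₁) (by simp [C.e_t])) ≫
          P.map (P.η.app (pullback C.t C.s)))
      (pullback.fst (P.map C.t) (D.one C.C₀) ≫
        P.map (lift (𝟙 C.C₁) (toUnit C.C₁ ≫ P.η.app (𝟙_ E))))]
    · rw [Category.assoc (pullback.fst _ _), Category.assoc (P.map _),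
        reassoc_of% Monad.map_η_map (P := P) C.m, P.right_unit, ← P.map_comp_assoc, C.id_comp,
        P.map_id, Category.id_comp]
      exact (Category.comp_id _).trans (Category.id_comp _).symm
    · rw [Category.assoc (pullback.fst _ _), Category.assoc (P.map _), Monad.map_η_map,
        ← P.map_comp_assoc, pullback.lift_fst]
      simp only [Category.assoc, ← P.map_comp, Monad.map_η, tUnit_fst, tSource]
    · rw [Category.assoc (pullback.fst _ _), Category.assoc (P.map _), Category.assoc (pullback.fst _ _),
        Monad.map_η_map, ← P.map_comp_assoc, pullback.lift_snd, P.map_id, Category.id_comp,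
        ← P.map_comp]
      congr 2
      -- Factoring through `C₁ × 1` exposes the unit axiom of the strength.
      have e : lift (𝟙 C.C₁) (toUnit C.C₁ ≫ P.η.app (𝟙_ E)) =
          lift (𝟙 C.C₁) (toUnit C.C₁) ≫ (C.C₁ ◁ P.η.app (𝟙_ E)) := by simp
      rw [e, Category.assoc, Strength.one, reassoc_of% D.unit C.C₁ (𝟙_ E), Monad.map_η,
        rightUnitor_hom,
        lift_fst_assoc, Category.id_comp]
    · rw [Category.assoc, ← P.map_comp, lift_fst, P.map_id, Category.comp_id, Category.id_comp]
    · simp only [Category.assoc, ← P.map_comp, lift_snd, tSource, tUnit_weight]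
      rw [← Category.assoc C.s, toUnit_unique (C.s ≫ toUnit C.C₀)]
  · rw [Category.assoc, tComp_target, pullback.lift_snd_assoc]

theorem tComp_id_right (C : InternalCat E)
    (h : P.η.app (tOps D C) ≫ P.map (tTarget D C) = (tTarget D C ≫ tUnit D C) ≫ tSource D C) :
    pullback.lift (P.η.app (tOps D C)) (tTarget D C ≫ tUnit D C) h ≫ tComp D C = 𝟙 _ := by
  have hz : lift (tTarget D C) (tWeight D C) = pullback.snd (P.map C.t) (D.one C.C₀) := by
    ext <;> simp
  apply tOps_hom_ext
  -- Now the outer operation is a unit: each arrow is followed by the identity of its target, and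
  -- the whole word becomes one letter of an outer word, so `η` is taken at `P C₂`. The one outer
  -- arrow is the identity of the target, carrying the full weight.
  · rw [Category.assoc, lift_tComp_fst D _ _ _
      (pullback.fst (P.map C.t) (D.one C.C₀) ≫
        P.map (pullback.lift (𝟙 C.C₁) (C.t ≫ C.e) (by simp [C.e_s])) ≫
          P.η.app (P.obj (pullback C.t C.s)))
      (lift (tTarget D C ≫ C.e) (tWeight D C) ≫ P.η.app (C.C₁ ⊗ P.obj (𝟙_ E)))]
    · rw [Category.assoc, Category.assoc, reassoc_of% Monad.map_η (P.map C.m), P.left_unit,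
        ← P.map_comp_assoc, C.comp_id, P.map_id, Category.id_comp]
      exact (Category.comp_id _).trans (Category.id_comp _).symm
    · rw [Category.assoc, Category.assoc, Monad.map_η, Monad.map_η, ← P.map_comp_assoc,
        pullback.lift_fst, P.map_id, Category.id_comp]
    · have e : lift (tTarget D C ≫ C.e) (tWeight D C) =
          pullback.snd (P.map C.t) (D.one C.C₀) ≫ (C.e ▷ P.obj (𝟙_ E)) := by
        rw [← hz, lift_whiskerRight]
      rw [Category.assoc (pullback.fst _ _), Category.assoc (P.map _), Category.assoc (lift _ _),
        Monad.map_η, Monad.map_η,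
        ← P.map_comp_assoc, pullback.lift_snd, e, Category.assoc,
        reassoc_of% D.one_naturality C.e,
        ← reassoc_of% pullback.condition (f := P.map C.t) (g := D.one C.C₀), P.map_comp,
        Category.assoc]
    · rw [Category.assoc (lift _ _), Monad.map_η, lift_fst_assoc, Category.assoc (tTarget D C),
        Category.assoc (tTarget D C), tUnit_fst, Monad.map_η]
    · rw [Category.assoc, Monad.map_η, Monad.map_η, lift_snd_assoc]
  · rw [Category.assoc, tComp_target, pullback.lift_snd_assoc, Category.assoc (tTarget D C),
      tUnit_target, Category.comp_id]
    exact (Category.id_comp _).symm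

end T

end TConstruction
namespace TConstruction

/-! ### Associativity of the composition -/

section T

set_option linter.unusedSectionVars false

variable {E : Type u} [Category.{v} E] [CartesianMonoidalCategory E] [HasPullbacks E]
  {P : Monad E} (D : Strength P) [CartesianMonad P]

theorem map_tensor_hom_ext {A B W : E} {a b : W ⟶ P.obj (A ⊗ B)}
    (h : a ≫ P.map (fst A B) = b ≫ P.map (fst A B))
    (h' : a ≫ P.map (snd A B) = b ≫ P.map (snd A B)) : a = b :=
  (isPullback_map_fst_snd A B).hom_ext h h'

theorem map_map_tensor_hom_ext {A B W : E} {a b : W ⟶ P.obj (P.obj (A ⊗ B))}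
    (h : a ≫ P.map (P.map (fst A B)) = b ≫ P.map (P.map (fst A B)))
    (h' : a ≫ P.map (P.map (snd A B)) = b ≫ P.map (P.map (snd A B))) : a = b :=
  ((isPullback_map_fst_snd A B).map P.toFunctor).hom_ext h h'

theorem exists_map_tensor_lift {A B W : E} (a : W ⟶ P.obj A) (b : W ⟶ P.obj B)
    (h : a ≫ P.map (toUnit A) = b ≫ P.map (toUnit B)) :
    ∃ k : W ⟶ P.obj (A ⊗ B), k ≫ P.map (fst A B) = a ∧ k ≫ P.map (snd A B) = b :=
  ⟨(isPullback_map_fst_snd A B).lift a b h, IsPullback.lift_fst _ _ _ _,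
    IsPullback.lift_snd _ _ _ _⟩

theorem exists_map_map_tensor_lift {A B W : E} (a : W ⟶ P.obj (P.obj A))
    (b : W ⟶ P.obj (P.obj B))
    (h : a ≫ P.map (P.map (toUnit A)) = b ≫ P.map (P.map (toUnit B))) :
    ∃ k : W ⟶ P.obj (P.obj (A ⊗ B)),
      k ≫ P.map (P.map (fst A B)) = a ∧ k ≫ P.map (P.map (snd A B)) = b :=
  ⟨((isPullback_map_fst_snd A B).map P.toFunctor).lift a b h, IsPullback.lift_fst _ _ _ _,
    IsPullback.lift_snd _ _ _ _⟩

theorem map_map_map_pullback_hom_ext {X Y Z W : E} {f : X ⟶ Z} {g : Y ⟶ Z}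
    {a b : W ⟶ P.obj (P.obj (P.obj (pullback f g)))}
    (h : a ≫ P.map (P.map (P.map (pullback.fst f g))) =
      b ≫ P.map (P.map (P.map (pullback.fst f g))))
    (h' : a ≫ P.map (P.map (P.map (pullback.snd f g))) =
      b ≫ P.map (P.map (P.map (pullback.snd f g)))) : a = b :=
  (((isPullback_map_pullback (P := P) f g).map P.toFunctor).map P.toFunctor).hom_ext h h'

theorem exists_map_map_map_pullback_lift {X Y Z W : E} {f : X ⟶ Z} {g : Y ⟶ Z}
    (a : W ⟶ P.obj (P.obj (P.obj X))) (b : W ⟶ P.obj (P.obj (P.obj Y)))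
    (h : a ≫ P.map (P.map (P.map f)) = b ≫ P.map (P.map (P.map g))) :
    ∃ k : W ⟶ P.obj (P.obj (P.obj (pullback f g))),
      k ≫ P.map (P.map (P.map (pullback.fst f g))) = a ∧
      k ≫ P.map (P.map (P.map (pullback.snd f g))) = b :=
  ⟨(((isPullback_map_pullback (P := P) f g).map P.toFunctor).map P.toFunctor).lift a b h,
    IsPullback.lift_fst _ _ _ _, IsPullback.lift_snd _ _ _ _⟩

/-- The two ways of composing three layers of operations, described by their composable arrows
`c₁`, `c₂` and the arrows with weights `d₁`, `d₂`, have the same component in `P C₁`. -/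
theorem exists_composable_assoc (C : InternalCat E) {Q Q₂ W : E} (i : Q ⟶ P.obj C.C₁)
    (w : Q ⟶ P.obj (𝟙_ E)) (m : Q₂ ⟶ Q) (x : Q₂ ⟶ P.obj Q) (y : Q₂ ⟶ Q)
    (u : Q₂ ⟶ P.obj (P.obj (pullback C.t C.s))) (d : Q₂ ⟶ P.obj (C.C₁ ⊗ P.obj (𝟙_ E)))
    (l : Q₂ ⟶ C.C₀ ⊗ P.obj (P.obj (𝟙_ E)))
    (hu : u ≫ P.map (P.map (pullback.fst C.t C.s)) = x ≫ P.map i)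
    (hu' : u ≫ P.map (P.map (pullback.snd C.t C.s)) = d ≫ P.map (D.one C.C₁))
    (hd : d ≫ P.map (fst C.C₁ (P.obj (𝟙_ E))) = y ≫ i)
    (hd' : d ≫ P.map (snd C.C₁ (P.obj (𝟙_ E))) = x ≫ P.map w)
    (hl : l ≫ D.app C.C₀ (P.obj (𝟙_ E)) = d ≫ P.map (C.t ▷ P.obj (𝟙_ E)))
    (hl' : l ≫ snd C.C₀ (P.obj (P.obj (𝟙_ E))) = x ≫ P.map w)
    (hm : m ≫ i = u ≫ P.map (P.map C.m) ≫ P.μ.app C.C₁)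
    (hmw : m ≫ w = x ≫ P.map w ≫ P.μ.app (𝟙_ E))
    (hw : w = i ≫ P.map (toUnit C.C₁))
    (hxy : x ≫ P.map w ≫ P.map (toUnit (P.obj (𝟙_ E))) = y ≫ w)
    (a : W ⟶ P.obj Q₂) (z : W ⟶ Q) (p : W ⟶ Q₂)
    (hx : p ≫ x = a ≫ P.map y) (hy : p ≫ y = z)
    (hz : z ≫ i ≫ P.map C.s = a ≫ P.map (l ≫ fst C.C₀ (P.obj (P.obj (𝟙_ E))))) :
    ∃ (c₁ c₂ : W ⟶ P.obj (P.obj (pullback C.t C.s)))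
      (d₁ d₂ : W ⟶ P.obj (C.C₁ ⊗ P.obj (𝟙_ E))),
      (c₁ ≫ P.map (P.map (pullback.fst C.t C.s)) = (a ≫ P.map m) ≫ P.map i ∧
        c₁ ≫ P.map (P.map (pullback.snd C.t C.s)) = d₁ ≫ P.map (D.one C.C₁) ∧
        d₁ ≫ P.map (fst C.C₁ (P.obj (𝟙_ E))) = z ≫ i ∧
        d₁ ≫ P.map (snd C.C₁ (P.obj (𝟙_ E))) = (a ≫ P.map m) ≫ P.map w) ∧
      (c₂ ≫ P.map (P.map (pullback.fst C.t C.s)) = (a ≫ P.map x ≫ P.μ.app Q) ≫ P.map i ∧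
        c₂ ≫ P.map (P.map (pullback.snd C.t C.s)) = d₂ ≫ P.map (D.one C.C₁) ∧
        d₂ ≫ P.map (fst C.C₁ (P.obj (𝟙_ E))) = (p ≫ m) ≫ i ∧
        d₂ ≫ P.map (snd C.C₁ (P.obj (𝟙_ E))) = (a ≫ P.map x ≫ P.μ.app Q) ≫ P.map w) ∧
      c₁ ≫ P.map (P.map C.m) ≫ P.μ.app C.C₁ = c₂ ≫ P.map (P.map C.m) ≫ P.μ.app C.C₁ := by
  rw [← P.map_comp] at hxy
  -- Here `a` holds the pairs of inner and middle operations, `z` the outer operation and `p` the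
  -- pair of middle and outer operations. `e` attaches to each outer arrow the two-level shape of
  -- the inner operations above it.
  obtain ⟨e, he, he'⟩ := exists_map_tensor_lift (P := P) (z ≫ i) (a ≫ P.map x ≫ P.map (P.map w))
    (by
      rw [← toUnit_unique (C.s ≫ toUnit C.C₀) (toUnit C.C₁), P.map_comp]
      simp only [Category.assoc]
      rw [reassoc_of% hz]
      simp only [← P.map_comp, Category.assoc]
      congr 2
      exact toUnit_unique _ _)
  -- `g` attaches to each composable pair of a middle and an outer arrow the weight of its inner
  -- operation.
  obtain ⟨g, hg, hg'⟩ := exists_map_map_tensor_lift (P := P) (p ≫ u)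
    (a ≫ P.map x ≫ P.map (P.map w))
    (by
      rw [← toUnit_unique (pullback.fst C.t C.s ≫ toUnit C.C₁) (toUnit _), P.map_comp, P.map_comp,
        Category.assoc, reassoc_of% hu, reassoc_of% hx, ← P.map_comp i, ← hw]
      simp only [← P.map_comp, Category.assoc, hxy])
  have hel : e ≫ P.map (C.s ▷ P.obj (P.obj (𝟙_ E))) = a ≫ P.map l := by
    apply map_tensor_hom_ext
    · rw [Category.assoc, ← P.map_comp, whiskerRight_fst, P.map_comp, reassoc_of% he, hz,
        Category.assoc, P.map_comp]
    · rw [Category.assoc, ← P.map_comp, whiskerRight_snd, he', Category.assoc, ← P.map_comp,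
        ← P.map_comp, hl']
  -- The composable triples: the inner and middle arrows come from `a`, and the outer arrow is
  -- copied over two levels by the strength. They match by naturality of the strength along the
  -- source map, together with `hel` and `hl`.
  obtain ⟨k, hk, hk'⟩ := exists_map_map_map_pullback_lift (P := P)
    (f := pullback.snd C.t C.s ≫ C.t) (g := C.s) (a ≫ P.map u)
    (e ≫ P.map (D.app C.C₁ (P.obj (𝟙_ E))) ≫ P.map (P.map (D.one C.C₁)))
    (by
      have h1 := D.naturality C.s (𝟙 (P.obj (𝟙_ E)))
      rw [P.map_id, tensorHom_id, tensorHom_id] at h1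
      simp only [Category.assoc, P.map_comp]
      rw [← P.map_comp (P.map (D.one C.C₁)), ← P.map_comp (D.one C.C₁), ← D.one_naturality,
        P.map_comp, P.map_comp, ← P.map_comp_assoc (D.app C.C₁ _), ← h1, P.map_comp,
        Category.assoc, reassoc_of% hel, ← P.map_comp_assoc l, hl, ← P.map_comp_assoc u, hu']
      simp only [← P.map_comp, Category.assoc]
      rw [D.one_naturality])
  -- The next facts compare `e` and `g` with the given data: `hag` for the middle arrows with inner
  -- weights, `hep` for the outer arrows with middle weights, `heg` for the outer arrows spread over
  -- the middle layer.
  have hag : a ≫ P.map d = g ≫ P.map (P.map (pullback.fst C.t C.s ▷ P.obj (𝟙_ E))) := by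
    apply map_map_tensor_hom_ext
    · rw [Category.assoc, Category.assoc, ← P.map_comp, hd, ← P.map_comp, ← P.map_comp,
        whiskerRight_fst, P.map_comp, P.map_comp, P.map_comp, reassoc_of% hg, hu, reassoc_of% hx]
    · rw [Category.assoc, Category.assoc, ← P.map_comp, hd', ← P.map_comp, ← P.map_comp,
        whiskerRight_snd, hg', P.map_comp]
  have hep : e ≫ P.map (C.C₁ ◁ P.map (toUnit (P.obj (𝟙_ E)))) = p ≫ d := by
    apply map_tensor_hom_ext
    · rw [Category.assoc, Category.assoc, ← P.map_comp, whiskerLeft_fst, he, hd, reassoc_of% hy]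
    · rw [Category.assoc, Category.assoc, ← P.map_comp, whiskerLeft_snd, hd', reassoc_of% hx,
        P.map_comp, reassoc_of% he']
      simp only [← P.map_comp, hxy]
  have heg : e ≫ P.map (D.app C.C₁ (P.obj (𝟙_ E))) =
      g ≫ P.map (P.map (pullback.snd C.t C.s ▷ P.obj (𝟙_ E))) := by
    apply map_map_tensor_hom_ext
    · rw [Category.assoc, Category.assoc, ← P.map_comp, D.app_toUnit, ← P.map_comp, ← P.map_comp,
        whiskerRight_fst, P.map_comp, P.map_comp, P.map_comp, reassoc_of% hg, hu', reassoc_of% hep]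
    · rw [Category.assoc, Category.assoc, ← P.map_comp, D.app_snd, ← P.map_comp, ← P.map_comp,
        whiskerRight_snd, hg', he']
  -- The last two arrows of each triple are the pairs of `g`, spread over the inner layer by the
  -- strength.
  have hkg : k ≫ P.map (P.map (P.map (pullback.lift (f := C.t) (g := C.s)
        (pullback.fst (pullback.snd C.t C.s ≫ C.t) C.s ≫ pullback.snd C.t C.s)
        (pullback.snd (pullback.snd C.t C.s ≫ C.t) C.s)
        (by rw [Category.assoc, pullback.condition])))) =
      g ≫ P.map (P.map (D.one (pullback C.t C.s))) := by
    apply map_map_map_pullback_hom_ext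
    · simp only [Category.assoc, ← P.map_comp, pullback.lift_fst, ← D.one_naturality]
      simp only [P.map_comp]
      rw [reassoc_of% hk, ← reassoc_of% hag]
      simp only [← P.map_comp, hu']
    · simp only [Category.assoc, ← P.map_comp, pullback.lift_snd, ← D.one_naturality]
      simp only [P.map_comp]
      rw [hk', reassoc_of% heg]
  -- `c₁` composes the first two arrows of each triple and flattens the two inner levels by `P μ`;
  -- `c₂` composes the last two and flattens the two outer levels by `μ`. `d₁` and `d₂` are the
  -- outer factors of these, with the flattened or the inner weights.
  refine ⟨k ≫ P.map (P.map (P.map (pullback.lift (f := C.t) (g := C.s)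
      (pullback.fst (pullback.snd C.t C.s ≫ C.t) C.s ≫ C.m)
      (pullback.snd (pullback.snd C.t C.s ≫ C.t) C.s)
      (by rw [Category.assoc, C.m_t, pullback.condition])))) ≫ P.map (P.μ.app _),
    k ≫ P.map (P.map (P.map (pullback.lift (f := C.t) (g := C.s)
      (pullback.fst (pullback.snd C.t C.s ≫ C.t) C.s ≫ pullback.fst C.t C.s)
      (pullback.lift (f := C.t) (g := C.s)
        (pullback.fst (pullback.snd C.t C.s ≫ C.t) C.s ≫ pullback.snd C.t C.s)
        (pullback.snd (pullback.snd C.t C.s ≫ C.t) C.s)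
        (by rw [Category.assoc, pullback.condition]) ≫ C.m)
      (by rw [Category.assoc, Category.assoc, C.m_s, pullback.lift_fst_assoc, Category.assoc,
        pullback.condition])))) ≫ P.μ.app _,
    e ≫ P.map (C.C₁ ◁ P.μ.app (𝟙_ E)),
    g ≫ P.map (P.map (C.m ▷ P.obj (𝟙_ E))) ≫ P.μ.app _,
    ⟨?_, ?_, ?_, ?_⟩, ⟨?_, ?_, ?_, ?_⟩, ?_⟩
  · simp only [Category.assoc, ← P.map_comp, Monad.map_μ, hm]
    simp only [P.map_comp]
    rw [← P.map_comp_assoc (P.map (P.map _)), ← P.map_comp (P.map _),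
      ← P.map_comp (pullback.lift _ _ _),
      pullback.lift_fst, P.map_comp, P.map_comp, P.map_comp, Category.assoc, reassoc_of% hk]
  · simp only [Category.assoc, ← P.map_comp, Monad.map_μ, D.one_mult]
    simp only [P.map_comp]
    rw [← P.map_comp_assoc (P.map (P.map _)), ← P.map_comp (P.map _),
      ← P.map_comp (pullback.lift _ _ _),
      pullback.lift_snd, reassoc_of% hk']
  · rw [Category.assoc, ← P.map_comp, whiskerLeft_fst, he]
  · rw [Category.assoc, Category.assoc, ← P.map_comp, whiskerLeft_snd, ← P.map_comp m, hmw,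
      P.map_comp, P.map_comp, P.map_comp, reassoc_of% he']
  · simp only [Category.assoc, Monad.map_μ]
    rw [← P.map_comp_assoc (P.map (P.map _)), ← P.map_comp (P.map _),
      ← P.map_comp (pullback.lift _ _ _),
      pullback.lift_fst, P.map_comp, P.map_comp, P.map_comp, Category.assoc, reassoc_of% hk,
      ← P.map_comp_assoc u, hu, P.map_comp_assoc]
  · simp only [Category.assoc, Monad.map_μ]
    rw [← P.map_comp_assoc (P.map (P.map _)), ← P.map_comp (P.map _),
      ← P.map_comp (pullback.lift _ _ _),
      pullback.lift_snd, P.map_comp, P.map_comp, P.map_comp, Category.assoc, reassoc_of% hkg,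
      ← P.map_comp_assoc (P.map (C.m ▷ _)), ← P.map_comp (C.m ▷ _), D.one_naturality, P.map_comp,
      P.map_comp, Category.assoc]
  · simp only [Category.assoc, Monad.map_μ, hm]
    rw [← P.map_comp_assoc (P.map (C.m ▷ _)), ← P.map_comp (C.m ▷ _), whiskerRight_fst, P.map_comp,
      P.map_comp, Category.assoc, reassoc_of% hg]
  · simp only [Category.assoc, Monad.map_μ]
    rw [← P.map_comp_assoc (P.map (C.m ▷ _)), ← P.map_comp (C.m ▷ _), whiskerRight_snd,
      reassoc_of% hg']
  -- Naturality brings both sides to `P³` of a triple composite followed by the two multiplications.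
  -- Associativity of `P` and then of `C` identifies them.
  · simp only [Category.assoc]
    rw [← P.map_comp_assoc (P.μ.app _), Monad.map_μ, reassoc_of% Monad.map_μ (P.map C.m),
      P.map_comp_assoc, P.assoc]
    simp only [← P.map_comp_assoc, ← P.map_comp]
    rw [C.assoc]

theorem tPairs.toLast_fst' (C : InternalCat E) :
    tPairs.toLast D C ≫ fst C.C₀ (P.obj (P.obj (𝟙_ E))) =
      pullback.snd (P.map (tTarget D C)) (tSource D C) ≫ tTarget D C := by
  have h := tPairs.toLast_fst D C
  rw [← whiskerLeft_fst C.C₀ (P.map (toUnit (P.obj (𝟙_ E)))), reassoc_of% h]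

theorem tPairs.toLast_snd' (C : InternalCat E) :
    tPairs.toLast D C ≫ snd C.C₀ (P.obj (P.obj (𝟙_ E))) =
      pullback.fst (P.map (tTarget D C)) (tSource D C) ≫ P.map (tWeight D C) := by
  have h := tPairs.toLast_snd D C
  rw [← D.app_snd, reassoc_of% h, ← P.map_comp, whiskerRight_snd, tPairs.toMid_snd]

/-- By `tWeight_eq` only the shape of the composed word matters, and it does not change when each
composite is replaced by its first arrow. -/
theorem tComp_weight (C : InternalCat E) :
    tComp D C ≫ tWeight D C =
      pullback.fst (P.map (tTarget D C)) (tSource D C) ≫ P.map (tWeight D C) ≫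
        P.μ.app (𝟙_ E) := by
  have h := tComp_fst D C
  have h' := tPairs.toComposable_fst D C
  rw [tWeight_eq, reassoc_of% h, Monad.map_μ, ← P.map_comp_assoc, ← P.map_comp,
    toUnit_unique (C.m ≫ toUnit C.C₁) (pullback.fst C.t C.s ≫ toUnit C.C₁), P.map_comp,
    P.map_comp, Category.assoc, reassoc_of% h', ← P.map_comp_assoc (pullback.fst _ _)]

/-- The weights of the inner operations of a pair lie over the weight of the outer one. -/
theorem tPairs.weight_condition (C : InternalCat E) :
    pullback.fst (P.map (tTarget D C)) (tSource D C) ≫ P.map (tWeight D C) ≫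
        P.map (toUnit (P.obj (𝟙_ E))) =
      pullback.snd (P.map (tTarget D C)) (tSource D C) ≫ tWeight D C := by
  rw [← P.map_comp, toUnit_unique (tWeight D C ≫ toUnit _) (tTarget D C ≫ toUnit C.C₀),
    P.map_comp (tTarget D C), ← Category.assoc, pullback.condition, Category.assoc, tWeight_eq,
    Category.assoc, ← P.map_comp C.s, toUnit_unique (C.s ≫ toUnit C.C₀) (toUnit C.C₁)]

theorem tComp_assoc (C : InternalCat E) {W : E} (a : W ⟶ P.obj (tPairs D C)) (z : W ⟶ tOps D C)
    (h₁ : (a ≫ P.map (tComp D C)) ≫ P.map (tTarget D C) = z ≫ tSource D C)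
    (h₂ : (a ≫ P.map (pullback.snd (P.map (tTarget D C)) (tSource D C))) ≫
      P.map (tTarget D C) = z ≫ tSource D C)
    (h₃ : (a ≫ P.map (pullback.fst (P.map (tTarget D C)) (tSource D C)) ≫ P.μ.app (tOps D C)) ≫
      P.map (tTarget D C) = (pullback.lift (a ≫
        P.map (pullback.snd (P.map (tTarget D C)) (tSource D C))) z h₂ ≫ tComp D C) ≫
          tSource D C) :
    pullback.lift (a ≫ P.map (tComp D C)) z h₁ ≫ tComp D C =
      pullback.lift (a ≫ P.map (pullback.fst (P.map (tTarget D C)) (tSource D C)) ≫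
        P.μ.app (tOps D C)) (pullback.lift (a ≫
          P.map (pullback.snd (P.map (tTarget D C)) (tSource D C))) z h₂ ≫ tComp D C) h₃ ≫
      tComp D C := by
  obtain ⟨c₁, c₂, d₁, d₂, ⟨h11, h12, h13, h14⟩, ⟨h21, h22, h23, h24⟩, h⟩ :=
    exists_composable_assoc D C (pullback.fst (P.map C.t) (D.one C.C₀)) (tWeight D C) (tComp D C)
      (pullback.fst (P.map (tTarget D C)) (tSource D C))
      (pullback.snd (P.map (tTarget D C)) (tSource D C))
      (tPairs.toComposable D C) (tPairs.toMid D C) (tPairs.toLast D C)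
      (tPairs.toComposable_fst D C) (tPairs.toComposable_snd D C) (tPairs.toMid_fst D C)
      (tPairs.toMid_snd D C) (tPairs.toLast_snd D C) (tPairs.toLast_snd' D C) (tComp_fst D C)
      (tComp_weight D C) (tWeight_eq D C) (tPairs.weight_condition D C) a z
      (pullback.lift (a ≫ P.map (pullback.snd (P.map (tTarget D C)) (tSource D C))) z h₂)
      (pullback.lift_fst _ _ _) (pullback.lift_snd _ _ _)
      (by
        rw [tPairs.toLast_fst', P.map_comp, ← Category.assoc a]
        exact h₂.symm)
  apply tOps_hom_ext
  · rw [Category.assoc, Category.assoc, lift_tComp_fst D _ _ _ c₁ d₁ h11 h12 h13 h14,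
      lift_tComp_fst D _ _ _ c₂ d₂ h21 h22 h23 h24, h]
  · refine (Category.assoc _ _ _).trans (Eq.trans ?_ (Category.assoc _ _ _).symm)
    rw [tComp_target, pullback.lift_snd_assoc, pullback.lift_snd_assoc]
    refine Eq.trans ?_ (Category.assoc _ _ _).symm
    rw [tComp_target, pullback.lift_snd_assoc]

/-- The construction yields operads. -/
theorem T_isOperad (C : InternalCat E) : (T D C).IsOperad where
  m_s := tComp_source D C
  m_t := tComp_target D C
  e_s := tUnit_source D C
  e_t := tUnit_target D C
  assoc := tComp_assoc D C _ _ _ _ _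
  id_left := tComp_id_left D C _
  id_right := tComp_id_right D C _

/-- The functor from internal categories to operads. -/
noncomputable def tFunctor : InternalCat E ⥤ POperad P where
  obj C := ⟨T D C, T_isOperad D C⟩
  map f := ObjectProperty.homMk (tHom D f)
  map_id C := by
    ext1
    exact PreOperad.Hom.ext rfl (tMap_id D C)
  map_comp f g := by
    ext1
    exact PreOperad.Hom.ext rfl (tMap_comp D f g)

end T

end TConstruction
-- Monoids and Giraudo's operad
namespace TConstruction

/-- A morphism of (pre-)operads with invertible components is an isomorphism. -/
noncomputable def PreOperad.isoOfHom {E : Type u} [Category.{v} E] [HasPullbacks E] {P : Monad E}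
    {Q R : PreOperad P} (f : Q ⟶ R) (h₀ : IsIso (PreOperad.Hom.f₀ f))
    (h₁ : IsIso (PreOperad.Hom.f₁ f)) : Q ≅ R where
  hom := f
  inv :=
    { f₀ := inv (PreOperad.Hom.f₀ f)
      f₁ := inv (PreOperad.Hom.f₁ f)
      comm_s := by
        rw [Functor.map_inv, IsIso.comp_inv_eq, Category.assoc, PreOperad.Hom.comm_s f,
          IsIso.inv_hom_id_assoc]
      comm_t := by
        rw [IsIso.comp_inv_eq, Category.assoc, PreOperad.Hom.comm_t f, IsIso.inv_hom_id_assoc]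
      comm_e := by
        rw [IsIso.comp_inv_eq, Category.assoc, PreOperad.Hom.comm_e f, IsIso.inv_hom_id_assoc]
      comm_m := by
        rw [IsIso.comp_inv_eq, Category.assoc, PreOperad.Hom.comm_m f, ← Category.assoc,
          pullback.map_comp]
        simp }
  hom_inv_id := PreOperad.Hom.ext (IsIso.hom_inv_id _) (IsIso.hom_inv_id _)
  inv_hom_id := PreOperad.Hom.ext (IsIso.inv_hom_id _) (IsIso.inv_hom_id _)

/-- Discarding `A` from `D_A` leaves the projection to `P 1`, which is invertible when `A` is
terminal, as is `P` of the map `A ⟶ 1`. -/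
theorem Strength.isIso_one {E : Type u} [Category.{v} E] [CartesianMonoidalCategory E]
    [HasPullbacks E] {P : Monad E} (D : Strength P) (A : E) [IsIso (toUnit A)] :
    IsIso (D.one A) := by
  have : IsIso (snd A (P.obj (𝟙_ E))) := by
    have h : snd A (P.obj (𝟙_ E)) = (toUnit A ▷ _) ≫ (λ_ _).hom := by
      rw [leftUnitor_hom, whiskerRight_snd]
    rw [h]
    infer_instance
  have : IsIso (D.one A ≫ P.map (toUnit A)) := by
    rw [D.one_toUnit]
    infer_instance
  exact IsIso.of_isIso_comp_right _ (P.map (toUnit A))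

theorem letters_giraudoPartial {Y : Type u} [Monoid Y] (x : FreeSemigroup Y)
    (i : Fin (letters x).length) (y : FreeSemigroup Y) :
    letters (giraudoPartial x i y) = (letters x).take i ++
      (letters y).map (fun b => (letters x)[i] * b) ++ (letters x).drop (i + 1) :=
  letters_word _ _

/-- Inserting operations in all the letters of a suffix `B` of `x`. -/
theorem letters_foldr_giraudoPartial {Y : Type u} [Monoid Y] (x : FreeSemigroup Y) :
    ∀ (ys : List (FreeSemigroup Y)) (A B : List Y), letters x = A ++ B → B.length = ys.length →
      letters ((ys.zipIdx A.length).foldr (fun p z =>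
        if h : p.2 < (letters z).length then giraudoPartial z ⟨p.2, h⟩ p.1 else z) x) =
        A ++ (B.zip ys).flatMap fun p => (letters p.2).map (p.1 * ·)
  | [], A, B, hx, hB => by
    obtain rfl : B = [] := List.length_eq_zero_iff.1 hB
    simpa using hx
  | y :: ys, A, [], hx, hB => by simp at hB
  | y :: ys, A, b :: B, hx, hB => by
    -- The right fold inserts the last operations first, so the prefix `A ++ [b]` is still intact
    -- when `y` is inserted at the position `A.length` of `b`.
    have ih := letters_foldr_giraudoPartial x ys (A ++ [b]) B (by simpa using hx)
      (by simpa using hB)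
    rw [List.length_append, List.length_singleton] at ih
    rw [List.zipIdx_cons, List.foldr_cons]
    generalize (ys.zipIdx (A.length + 1)).foldr _ x = z at ih ⊢
    rw [dif_pos (by simp [ih]), letters_giraudoPartial]
    simp [ih]

/-- The total composition in Giraudo's operad. -/
theorem letters_giraudoTotal {Y : Type u} [Monoid Y] (x : FreeSemigroup Y)
    (ys : List (FreeSemigroup Y)) (h : (letters x).length = ys.length) :
    letters (giraudoTotal x ys) =
      ((letters x).zip ys).flatMap fun p => (letters p.2).map (p.1 * ·) :=
  letters_foldr_giraudoPartial x ys [] (letters x) rfl h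

theorem letters_mu_map_map {A B : Type u} (f : A ⟶ B) (c : FreeSemigroup (FreeSemigroup A)) :
    letters (freeSemigroupMonad.μ.app B (freeSemigroupMonad.map (freeSemigroupMonad.map f) c)) =
      (letters c).flatMap fun v => (letters v).map f := by
  refine (letters_mu _).trans ((congrArg (List.flatMap letters)
    (letters_map (FreeSemigroup.map f) c)).trans ?_)
  rw [List.flatMap_map]
  exact congrArg (fun k => List.flatMap k (letters c)) (funext fun v => letters_map f v)

theorem pullback_map_fst_apply {W X Y Z S T : Type u} (f₁ : W ⟶ S) (f₂ : X ⟶ S) (g₁ : Y ⟶ T)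
    (g₂ : Z ⟶ T) (i₁ : W ⟶ Y) (i₂ : X ⟶ Z) (i₃ : S ⟶ T) (h₁ : f₁ ≫ i₃ = i₁ ≫ g₁)
    (h₂ : f₂ ≫ i₃ = i₂ ≫ g₂) (w : (pullback f₁ f₂ : Type u)) :
    pullback.fst g₁ g₂ (pullback.map f₁ f₂ g₁ g₂ i₁ i₂ i₃ h₁ h₂ w) =
      i₁ (pullback.fst f₁ f₂ w) :=
  ConcreteCategory.congr_hom (pullback.lift_fst (f := g₁) (g := g₂) _ _ _) w

theorem pullback_map_snd_apply {W X Y Z S T : Type u} (f₁ : W ⟶ S) (f₂ : X ⟶ S) (g₁ : Y ⟶ T)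
    (g₂ : Z ⟶ T) (i₁ : W ⟶ Y) (i₂ : X ⟶ Z) (i₃ : S ⟶ T) (h₁ : f₁ ≫ i₃ = i₁ ≫ g₁)
    (h₂ : f₂ ≫ i₃ = i₂ ≫ g₂) (w : (pullback f₁ f₂ : Type u)) :
    pullback.snd g₁ g₂ (pullback.map f₁ f₂ g₁ g₂ i₁ i₂ i₃ h₁ h₂ w) =
      i₂ (pullback.snd f₁ f₂ w) :=
  ConcreteCategory.congr_hom (pullback.lift_snd (f := g₁) (g := g₂) _ _ _) w

/-- The hypothesis says that `q` is constant on each word of `c`, with value the corresponding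
letter of `d`. Multiplying a whole word by that letter is then the same as multiplying letter by
letter. -/
theorem zip_flatMap_eq {A Y Z : Type u} [Monoid Y] (p q : A → Y) :
    ∀ (c : List (FreeSemigroup A)) (d : List (Y × FreeSemigroup Z)),
      c.map (FreeSemigroup.map q) = d.map (fun r => FreeSemigroup.map (fun _ => r.1) r.2) →
      ((d.map Prod.fst).zip (c.map (FreeSemigroup.map p))).flatMap
          (fun r => (letters r.2).map (r.1 * ·)) =
        c.flatMap fun v => (letters v).map fun e => q e * p e
  | [], d, h => by simp
  | v :: c, [], h => by simp at h
  | v :: c, r :: d, h => by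
    rw [List.map_cons, List.map_cons, List.cons.injEq] at h
    have h' := congrArg letters h.1
    rw [letters_map, letters_map] at h'
    have hq : ∀ e ∈ letters v, q e = r.1 := fun e he => by
      have := List.mem_map_of_mem (f := q) he
      rw [h'] at this
      obtain ⟨_, _, h⟩ := List.mem_map.1 this
      exact h.symm
    rw [List.map_cons, List.map_cons, List.zip_cons_cons, List.flatMap_cons, List.flatMap_cons,
      zip_flatMap_eq p q c d h.2, letters_map, List.map_map]
    congr 1
    exact List.map_congr_left fun e he => by simp [hq e he]

theorem freeSemigroupStrength_one_apply (A : Type u)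
    (r : A × FreeSemigroup (𝟙_ (Type u) : Type u)) :
    freeSemigroupStrength.one A r = FreeSemigroup.map (fun _ => r.1) r.2 :=
  map_map_word (fun s : A × (𝟙_ (Type u) : Type u) => s.1) (fun b => (r.1, b)) r.2

/-- The strength copies the outer letter `xᵢ` along the `i`-th inner word, and the composition of
`monoidCat Y` puts the second arrow on the left, so the letters are the `xᵢ yᵢⱼ` of
`letters_giraudoTotal`. -/
theorem monoidCat_comm_m (Y : Type u) [Monoid Y]
    (w : (tPairs freeSemigroupStrength (monoidCat Y) : Type u)) :
    pullback.fst (freeSemigroupMonad.map (monoidCat Y).t)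
        (freeSemigroupStrength.one (monoidCat Y).C₀)
        (tComp freeSemigroupStrength (monoidCat Y) w) =
      giraudoTotal (Y := Y)
        (pullback.fst (freeSemigroupMonad.map (monoidCat Y).t)
          (freeSemigroupStrength.one (monoidCat Y).C₀)
          (pullback.snd (freeSemigroupMonad.map (tTarget freeSemigroupStrength (monoidCat Y)))
            (tSource freeSemigroupStrength (monoidCat Y)) w))
        (letters (freeSemigroupMonad.map (pullback.fst (freeSemigroupMonad.map (monoidCat Y).t)
          (freeSemigroupStrength.one (monoidCat Y).C₀))
          (pullback.fst (freeSemigroupMonad.map (tTarget freeSemigroupStrength (monoidCat Y)))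
            (tSource freeSemigroupStrength (monoidCat Y)) w))) := by
  have h := ConcreteCategory.congr_hom (tComp_fst freeSemigroupStrength (monoidCat Y)) w
  have h₁ := ConcreteCategory.congr_hom
    (tPairs.toComposable_fst freeSemigroupStrength (monoidCat Y)) w
  have h₂ := ConcreteCategory.congr_hom
    (tPairs.toComposable_snd freeSemigroupStrength (monoidCat Y)) w
  have h₃ := ConcreteCategory.congr_hom (tPairs.toMid_fst freeSemigroupStrength (monoidCat Y)) w
  rw [ConcreteCategory.comp_apply, ConcreteCategory.comp_apply] at h h₁ h₂ h₃
  rw [ConcreteCategory.comp_apply] at h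
  -- Only the projections of the composable pairs and of the weighted outer arrows matter from here
  -- on.
  generalize tPairs.toComposable freeSemigroupStrength (monoidCat Y) w = c at h h₁ h₂
  generalize tPairs.toMid freeSemigroupStrength (monoidCat Y) w = d at h₂ h₃
  rw [h, ← h₁, ← h₃]
  have e₁ : letters (freeSemigroupMonad.map (freeSemigroupMonad.map
      (pullback.fst (monoidCat Y).t (monoidCat Y).s)) c) =
      (letters c).map (FreeSemigroup.map (pullback.fst (toPoint Y) (toPoint Y))) :=
    letters_map _ _
  have e₂ : letters (freeSemigroupMonad.map (freeSemigroupMonad.map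
      (pullback.snd (monoidCat Y).t (monoidCat Y).s)) c) =
      (letters c).map (FreeSemigroup.map (pullback.snd (toPoint Y) (toPoint Y))) :=
    letters_map _ _
  have e₃ : letters (freeSemigroupMonad.map (freeSemigroupStrength.one (monoidCat Y).C₁) d) =
      (letters d).map (fun r : Y × FreeSemigroup (𝟙_ (Type u) : Type u) =>
        FreeSemigroup.map (fun _ => r.1) r.2) :=
    (letters_map _ _).trans (List.map_congr_left fun r _ => freeSemigroupStrength_one_apply Y r)
  have e₄ : letters (freeSemigroupMonad.map (fst (monoidCat Y).C₁ (freeSemigroupMonad.obj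
      (𝟙_ (Type u)))) d) = (letters d).map (Prod.fst : Y × _ → Y) :=
    letters_map _ _
  have e₅ : letters (freeSemigroupMonad.μ.app (monoidCat Y).C₁
      (freeSemigroupMonad.map (freeSemigroupMonad.map (monoidCat Y).m) c)) =
      (letters c).flatMap fun v => (letters v).map (monoidMul Y) := 
    letters_mu_map_map (monoidMul Y) c
  -- The second arrows of the pairs are the outer letters repeated by the strength, as
  -- `zip_flatMap_eq` requires; the equality also gives the equal lengths needed at the end.
  have e₆ := e₂.symm.trans ((congrArg letters h₂).trans e₃)
  have e₇ := zip_flatMap_eq (pullback.fst (toPoint Y) (toPoint Y))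
    (pullback.snd (toPoint Y) (toPoint Y)) _ _ e₆
  apply letters_injective
  refine e₅.trans (Eq.trans ?_ (letters_giraudoTotal (Y := Y) _ _ ?_).symm)
  · exact e₇.symm.trans (congrArg₂ (fun k l => List.flatMap _ (List.zip k l)) e₄.symm e₁.symm)
  · have h₄ := (List.length_map _).symm.trans ((congrArg List.length e₆).trans (List.length_map _))
    exact (congrArg List.length e₄).trans ((List.length_map _).trans
      (h₄.symm.trans ((List.length_map _).symm.trans (congrArg List.length e₁).symm)))

/-- The comparison of the construction on a monoid with Giraudo's operad. -/
noncomputable def giraudoHom (Y : Type u) [Monoid Y] :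
    T freeSemigroupStrength (monoidCat Y) ⟶ giraudo Y where
  f₀ := 𝟙 (PUnit : Type u)
  f₁ := pullback.fst (freeSemigroupMonad.map (monoidCat Y).t)
    (freeSemigroupStrength.one (monoidCat Y).C₀)
  comm_s := (congrArg _ (freeSemigroupMonad.map_id _)).trans (Category.comp_id _)
  comm_t := rfl
  comm_e := tUnit_fst freeSemigroupStrength (monoidCat Y)
  comm_m := by
    refine ConcreteCategory.hom_ext _ _ fun w => ?_
    refine (monoidCat_comm_m Y w).trans ?_
    refine congrArg₂ (giraudoTotal (Y := Y)) ?_ (congrArg letters ?_)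
    · exact (pullback_map_snd_apply _ _ _ _ _ _ _ _ _ w).symm
    · exact (pullback_map_fst_apply _ _ _ _ _ _ _ _ _ w).symm

/-- The construction on a monoid is isomorphic to Giraudo's operad. -/
noncomputable def giraudoIso (Y : Type u) [Monoid Y] :
    T freeSemigroupStrength (monoidCat Y) ≅ giraudo Y :=
  PreOperad.isoOfHom (giraudoHom Y) (inferInstanceAs (IsIso (𝟙 (PUnit : Type u)))) (by
    -- The object of colours is the one-point type, definitionally the monoidal unit. Hence `D_{C₀}`
    -- is invertible, and so is its pullback, the projection to `P Y`.
    have h : IsIso (toUnit (𝟙_ (Type u))) := by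
      rw [toUnit_unique (toUnit _) (𝟙 (𝟙_ (Type u)))]
      infer_instance
    have : IsIso (toUnit (monoidCat Y).C₀) := h
    have := freeSemigroupStrength.isIso_one (monoidCat Y).C₀
    exact inferInstanceAs (IsIso (pullback.fst (freeSemigroupMonad.map (monoidCat Y).t)
      (freeSemigroupStrength.one (monoidCat Y).C₀))))

end TConstruction

theorem mainTheorem4 :
    (∀ (E : Type u) [Category.{v} E] [CartesianMonoidalCategory E] [HasPullbacks E]
      (P : CategoryTheory.Monad E) [CartesianMonad P] (D : Strength P),
      -- `T^P(C)` is a `P`-operad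
      (∀ C : InternalCat E, Mono (D.one C.C₀) → (T D C).IsOperad) ∧
      -- functoriality in `C`
      (∀ (C B : InternalCat E) (f : C ⟶ B), Mono (D.one C.C₀) → Mono (D.one B.C₀) →
        ∃ g : T D C ⟶ T D B, g.f₀ = f.f₀ ∧ g.f₁ = tMap D f) ∧
      (∀ C : InternalCat E, tMap D (𝟙 C) = 𝟙 (tOps D C)) ∧
      (∀ (C B A : InternalCat E) (f : C ⟶ B) (g : B ⟶ A),
        tMap D (f ≫ g) = tMap D f ≫ tMap D g) ∧
      -- the functor from internal categories to `P`-operads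
      ((∀ A : E, Mono (D.one A)) →
        ∃ F : InternalCat E ⥤ POperad P,
          (∀ C : InternalCat E, (F.obj C).obj = T D C) ∧
          ∀ (C B : InternalCat E) (f : C ⟶ B),
            HEq (F.map f).hom.f₀ f.f₀ ∧ HEq (F.map f).hom.f₁ (tMap D f))) ∧
    -- for the free semigroup monad and a monoid, the construction gives Giraudo's operad
    (∀ (Y : Type w) [Monoid Y], (T freeSemigroupStrength (monoidCat Y)).IsOperad) ∧
    ∃ Φ : ∀ (Y : Type w) [Monoid Y], T freeSemigroupStrength (monoidCat Y) ≅ giraudo Y,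
      ∀ (Y Z : Type w) [Monoid Y] [Monoid Z] (f : Y →* Z),
        tMap freeSemigroupStrength.{w} (monoidCatMap f) ≫ PreOperad.Hom.f₁ (Φ Z).hom =
          PreOperad.Hom.f₁ (Φ Y).hom ≫ ↾(FreeSemigroup.map f) := by

  refine ⟨?_, ?_, ?_⟩
  · intro E _ _ _ P _ D
    exact ⟨fun C _ => T_isOperad D C, fun C B f _ _ => ⟨tHom D f, rfl, rfl⟩, tMap_id D,
      fun _ _ _ f g => tMap_comp D f g,
      fun _ => ⟨tFunctor D, fun _ => rfl, fun _ _ _ => ⟨HEq.rfl, HEq.rfl⟩⟩⟩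
  · exact fun Y _ => T_isOperad _ _
  -- The isomorphism is the projection to `P Y` on operations, so naturality is the description of
  -- `tMap` on that component.
  · exact ⟨fun Y _ => giraudoIso Y, fun Y Z _ _ f => tMap_fst freeSemigroupStrength (monoidCatMap f)⟩
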